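/- Let $0<\sigma<1$, $\ell>0$, $\Omega=(0,\pi)\times(-\ell,\ell)$, and let $H^2_*=\{w\in H^2(\Omega): w=0 \text{ on } \{0,\pi\}\times(-\ell,\ell)\}$ (elements of $H^2(\Omega)\subset C^0(\overline\Omega)$ are identified with their continuous representatives), with scalar product $$(u,v)_{H^2_*}=\int_\Omega\big[\Delta u\,\Delta v+(1-\sigma)(2u_{xy}v_{xy}-u_{xx}v_{yy}-u_{yy}v_{xx})\big]\,dx\,dy .$$ For $\alpha>0$, $\alpha\neq1$, let $$f_\alpha(x,y)=\frac{\alpha\,e^{\alpha y}\sin x}{4\sinh(\alpha\ell)} .$$ Then there is a unique $u_\alpha\in H^2_*$ with $(u_\alpha,v)_{H^2_*}=\int_\Omega f_\alpha v$ for all $v\in H^2_*$; it is of class $C^4$ up to the boundary and solves pointwise $$\begin{cases}\Delta^2u=f_\alpha&\text{in }\Omega,\\ u=u_{xx}=0&\text{on }\{0,\pi\}\times(-\ell,\ell),\\ u_{yy}+\sigma u_{xx}=u_{yyy}+(2-\sigma)u_{xxy}=0&\text{on }(0,\pi)\times\{\pm\ell\}.\end{cases}$$ Let $\mathcal G_\alpha(x)=u_\alpha(x,\ell)-u_\alpha(x,-\ell)$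 and $\mathcal G^\infty_\alpha=\max_{x\in[0,\pi]}|\mathcal G_\alpha(x)|$. Put $Q=(3+\sigma)\cosh\ell\,\sinh\ell+(1-\sigma)\ell$, $$\begin{aligned}B=\frac{1}{(1-\sigma)(\alpha^2-1)^2Q}\Big[&(1+\sigma)(\sigma-\alpha^2)\cosh\ell\,\sinh(\alpha\ell)+(1-\sigma)(\alpha^2-\sigma)\,\ell\sinh\ell\,\sinh(\alpha\ell)\\&+2\alpha(\alpha^2+\sigma-2)\sinh\ell\,\cosh(\alpha\ell)+(1-\sigma)\alpha(\alpha^2+\sigma-2)\,\ell\cosh\ell\,\cosh(\alpha\ell)\Big],\end{aligned}$$ $$C=\frac{\alpha(2-\sigma-\alpha^2)\sinh\ell\,\cosh(\alpha\ell)+(\sigma-\alpha^2)\cosh\ell\,\sinh(\alpha\ell)}{(\alpha^2-1)^2Q},$$ $$E(\ell,\alpha)=\frac{\alpha}{2(1-\alpha^2)^2}+\frac{\alpha B\sinh\ell}{2\sinh(\alpha\ell)}+\frac{\alpha C\,\ell\cosh\ell}{2\sinh(\alpha\ell)},\qquad E(\ell)=\frac{\sinh^2\ell}{(1-\sigma)\big[(1-\sigma)\ell+(3+\sigma)\sinh\ell\,\cosh\ell\big]}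 .$$ Then, for every $\alpha>0$, $\alpha\ne1$, $$\mathcal G_\alpha(x)=E(\ell,\alpha)\sin x\quad(x\in[0,\pi]),\qquad \mathcal G^\infty_\alpha=E(\ell,\alpha).$$ Moreover, as $\alpha\to+\infty$, $\mathcal G_\alpha(x)\to E(\ell)\sin x$ uniformly on $[0,\pi]$, and $$\mathcal G^\infty_\alpha=E(\ell)-\frac1\alpha\,\frac{(1+\sigma)\cosh\ell\,\sinh\ell+(1-\sigma)\ell}{2(1-\sigma)\big[(3+\sigma)\cosh\ell\,\sinh\ell+(1-\sigma)\ell\big]}+o\Big(\frac1\alpha\Big).$$ -/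

import Mathlib

open MeasureTheory Filter Topology Set
open scoped ContDiff

noncomputable section

/-- The plate `Ω = (0, π) × (-ℓ, ℓ)`; points are pairs `(x, y)`. -/
def plate (ℓ : ℝ) : Set (ℝ × ℝ) := Ioo 0 Real.pi ×ˢ Ioo (-ℓ) ℓ

/-- The closed plate `[0, π] × [-ℓ, ℓ]`. -/
def closedPlate (ℓ : ℝ) : Set (ℝ × ℝ) := Icc 0 Real.pi ×ˢ Icc (-ℓ) ℓ

/-- Classical partial derivative in `x`. -/
def partialX (u : ℝ × ℝ → ℝ) (p : ℝ × ℝ) : ℝ := fderiv ℝ u p (1, 0)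

/-- Classical partial derivative in `y`. -/
def partialY (u : ℝ × ℝ → ℝ) (p : ℝ × ℝ) : ℝ := fderiv ℝ u p (0, 1)

/-- Test functions: smooth with compact support contained in the open set `Ω`. -/
structure IsTestFunction (Ω : Set (ℝ × ℝ)) (φ : ℝ × ℝ → ℝ) : Prop where
  contDiff : ContDiff ℝ ∞ φ
  hasCompactSupport : HasCompactSupport φ
  tsupport_subset : tsupport φ ⊆ Ω

/-- `g` is the weak derivative of `u` in `Ω` with respect to `x`. -/
def IsWeakPartialX (Ω : Set (ℝ × ℝ)) (u g : ℝ × ℝ → ℝ) : Prop :=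
  ∀ φ, IsTestFunction Ω φ →
    ∫ p in Ω, u p * partialX φ p = - ∫ p in Ω, g p * φ p

/-- `g` is the weak derivative of `u` in `Ω` with respect to `y`. -/
def IsWeakPartialY (Ω : Set (ℝ × ℝ)) (u g : ℝ × ℝ → ℝ) : Prop :=
  ∀ φ, IsTestFunction Ω φ →
    ∫ p in Ω, u p * partialY φ p = - ∫ p in Ω, g p * φ p

/-- Square integrability on `Ω`. -/
def IsL2On (Ω : Set (ℝ × ℝ)) (g : ℝ × ℝ → ℝ) : Prop :=
  MemLp g 2 (volume.restrict Ω)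

/-- The space `H²_* = {w ∈ H²(Ω) : w = 0 on {0, π} × (-ℓ, ℓ)}`. Since `Ω` is a planar rectangle,
`H²(Ω) ⊂ C⁰(closure Ω)`; an element is given by its continuous representative on the closed plate,
together with (representatives of) its weak derivatives of order at most two, all of them in
`L²(Ω)`. The values of `toFun` outside the closed plate are irrelevant. -/
structure H2Star (ℓ : ℝ) where
  toFun : ℝ × ℝ → ℝ
  dx : ℝ × ℝ → ℝ
  dy : ℝ × ℝ → ℝ
  dxx : ℝ × ℝ → ℝ
  dxy : ℝ × ℝ → ℝ
  dyy : ℝ × ℝ → ℝ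
  continuousOn : ContinuousOn toFun (closedPlate ℓ)
  left_eq_zero : ∀ y ∈ Icc (-ℓ) ℓ, toFun (0, y) = 0
  right_eq_zero : ∀ y ∈ Icc (-ℓ) ℓ, toFun (Real.pi, y) = 0
  weak_dx : IsWeakPartialX (plate ℓ) toFun dx
  weak_dy : IsWeakPartialY (plate ℓ) toFun dy
  weak_dxx : IsWeakPartialX (plate ℓ) dx dxx
  weak_dxy : IsWeakPartialY (plate ℓ) dx dxy
  weak_dyy : IsWeakPartialY (plate ℓ) dy dyy
  memL2_dx : IsL2On (plate ℓ) dx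
  memL2_dy : IsL2On (plate ℓ) dy
  memL2_dxx : IsL2On (plate ℓ) dxx
  memL2_dxy : IsL2On (plate ℓ) dxy
  memL2_dyy : IsL2On (plate ℓ) dyy

/-- The scalar product `∫_Ω [Δu Δv + (1-σ)(2 u_xy v_xy - u_xx v_yy - u_yy v_xx)]` of `H²_*`. -/
def H2Star.scalarProduct {ℓ : ℝ} (σ : ℝ) (u v : H2Star ℓ) : ℝ :=
  ∫ p in plate ℓ,
    ((u.dxx p + u.dyy p) * (v.dxx p + v.dyy p)
      + (1 - σ) * (2 * u.dxy p * v.dxy p - u.dxx p * v.dyy p - u.dyy p * v.dxx p))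

/-- `u ∈ H²_*` is the (variational) solution of the plate problem with load `f`:
`(u, v) = ∫_Ω f v` for every `v ∈ H²_*`. -/
def IsWeakSolution {ℓ : ℝ} (σ : ℝ) (f : ℝ × ℝ → ℝ) (u : H2Star ℓ) : Prop :=
  ∀ v : H2Star ℓ, H2Star.scalarProduct σ u v = ∫ p in plate ℓ, f p * v.toFun p

/-- `u`, of class `C⁴` up to the boundary, solves pointwise the boundary value problem
`Δ²u = f` in `Ω`, hinged on the sides `x ∈ {0, π}` and free on the edges `y = ± ℓ`. -/
structure IsClassicalSolution (σ ℓ : ℝ) (f u : ℝ × ℝ → ℝ) : Prop where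
  contDiff : ContDiff ℝ 4 u
  bilaplacian : ∀ p ∈ plate ℓ,
    partialX (partialX (partialX (partialX u))) p
      + 2 * partialY (partialY (partialX (partialX u))) p
      + partialY (partialY (partialY (partialY u))) p = f p
  hinged : ∀ x ∈ ({0, Real.pi} : Set ℝ), ∀ y ∈ Ioo (-ℓ) ℓ,
    u (x, y) = 0 ∧ partialX (partialX u) (x, y) = 0
  free : ∀ x ∈ Ioo 0 Real.pi, ∀ y ∈ ({-ℓ, ℓ} : Set ℝ),
    partialY (partialY u) (x, y) + σ * partialX (partialX u) (x, y) = 0 ∧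
    partialY (partialY (partialY u)) (x, y)
      + (2 - σ) * partialY (partialX (partialX u)) (x, y) = 0

/-- The gap function `x ↦ u(x, ℓ) - u(x, -ℓ)`. -/
def gap (ℓ : ℝ) (u : ℝ × ℝ → ℝ) (x : ℝ) : ℝ := u (x, ℓ) - u (x, -ℓ)

/-- The maximal gap over `[0, π]`. -/
def maxGap (ℓ : ℝ) (u : ℝ × ℝ → ℝ) : ℝ :=
  sSup ((fun x => |gap ℓ u x|) '' Icc 0 Real.pi)

/-- The load `f_α(x, y) = α e^{αy} sin x / (4 sinh(αℓ))`. -/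
def load (ℓ α : ℝ) (p : ℝ × ℝ) : ℝ :=
  α * Real.exp (α * p.2) * Real.sin p.1 / (4 * Real.sinh (α * ℓ))

/-- The quantity `(3+σ) cosh ℓ sinh ℓ + (1-σ) ℓ`. -/
def denom (σ ℓ : ℝ) : ℝ :=
  (3 + σ) * Real.cosh ℓ * Real.sinh ℓ + (1 - σ) * ℓ

/-- The constant `B(1, ℓ, α)`. -/
def coeffB (σ ℓ α : ℝ) : ℝ :=
  ((1 + σ) * (σ - α ^ 2) * Real.cosh ℓ * Real.sinh (α * ℓ)
      + (1 - σ) * (α ^ 2 - σ) * ℓ * Real.sinh ℓ * Real.sinh (α * ℓ))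
    / ((1 - σ) * (α ^ 2 - 1) ^ 2 * denom σ ℓ)
  + (2 * α * (α ^ 2 + σ - 2) * Real.sinh ℓ * Real.cosh (α * ℓ)
      + (1 - σ) * α * (α ^ 2 + σ - 2) * ℓ * Real.cosh ℓ * Real.cosh (α * ℓ))
    / ((1 - σ) * (α ^ 2 - 1) ^ 2 * denom σ ℓ)

/-- The constant `C(1, ℓ, α)`. -/
def coeffC (σ ℓ α : ℝ) : ℝ :=
  (α * (2 - σ - α ^ 2) * Real.sinh ℓ * Real.cosh (α * ℓ)
      + (σ - α ^ 2) * Real.cosh ℓ * Real.sinh (α * ℓ))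
    / ((α ^ 2 - 1) ^ 2 * denom σ ℓ)

/-- The amplitude `E(ℓ, α)`, meaningful for `α > 0`, `α ≠ 1`. -/
def gapCoeff (σ ℓ α : ℝ) : ℝ :=
  α / (2 * (1 - α ^ 2) ^ 2)
    + α * coeffB σ ℓ α * Real.sinh ℓ / (2 * Real.sinh (α * ℓ))
    + α * coeffC σ ℓ α * ℓ * Real.cosh ℓ / (2 * Real.sinh (α * ℓ))

/-- The limit amplitude `E(ℓ)`. -/
def gapCoeffLimit (σ ℓ : ℝ) : ℝ :=
  Real.sinh ℓ ^ 2 / ((1 - σ) * ((1 - σ) * ℓ + (3 + σ) * Real.sinh ℓ * Real.cosh ℓ))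

end

/-! The load is a multiple of `sin x`, so the solution is sought as `sin x · φ(y)`. The plate
problem then becomes `φ'''' - 2φ'' + φ = κ e^{αy}`, with `φ'' = σφ` and `φ''' = (2-σ)φ'` at `y =
±ℓ`. Since `α² ≠ 1`, a particular solution is `κ e^{αy}/(α²-1)²`; the homogeneous solutions are
spanned by `cosh y`, `sinh y`, `y cosh y`, `y sinh y`. The edge conditions split into two 2×2
systems by the parity of `φ`. The odd one is solved by `coeffB` and `coeffC`. The even one only
needs to be solvable, because the even part cancels in the gap.

The candidate is a weak solution by integration by parts against an arbitrary element of `H²_*`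
(`H2Star.scalarProduct_sinMul`). No trace theory is used. Products `k(x) n(y)` reduce everything to
one variable, where the lemma of du Bois-Reymond represents a weakly differentiable function by a
primitive. A boundary term disappears either because the multiplier vanishes there or because the
element of `H²_*` is continuous and zero there.

Uniqueness (`IsWeakSolution.eqOn`) holds because the form is `σ(Δw)² + (1-σ)|D²w|²` on the diagonal,
so a difference `w` of two solutions has `w_xx = 0`. The hinged conditions then force `w = 0`.

The maximal gap is the amplitude itself, rather than its absolute value, because the amplitude is
nonnegative (`gapCoeff_nonneg`). By reciprocity it is the integral of the load against the solution
of the dual problem with opposite shears on the two free edges, and the odd part of that dual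
solution is nonnegative on `[0, ℓ]`. For the asymptotics, with `β = 1/α`, the amplitude is `M(β)
coth(αℓ) + R(β)`, where `M` is even and `R` odd, both rational and regular at `0`, and `coth(αℓ) -
1` is exponentially small. -/

/-- Smooth functions on the line whose support is a compact subset of `(a, b)`. -/
structure IsBumpOn (a b : ℝ) (φ : ℝ → ℝ) : Prop where
  contDiff : ContDiff ℝ ∞ φ
  hasCompactSupport : HasCompactSupport φ
  tsupport_subset : tsupport φ ⊆ Ioo a b

/-! ### Weak derivatives in one variable. -/

namespace IsBumpOn
variable {a b : ℝ} {φ ψ : ℝ → ℝ}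

lemma eq_zero_of_notMem (hφ : IsBumpOn a b φ) {t : ℝ} (ht : t ∉ Ioo a b) : φ t = 0 :=
  image_eq_zero_of_notMem_tsupport fun h => ht (hφ.tsupport_subset h)

lemma setIntegral_mul (hφ : IsBumpOn a b φ) (f : ℝ → ℝ) :
    ∫ t in Ioo a b, f t * φ t = ∫ t, f t * φ t :=
  setIntegral_eq_integral_of_forall_compl_eq_zero fun t ht => by
    rw [hφ.eq_zero_of_notMem ht, mul_zero]

lemma continuous (hφ : IsBumpOn a b φ) : Continuous φ := hφ.contDiff.continuous

lemma integrable (hφ : IsBumpOn a b φ) : Integrable φ :=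
  hφ.continuous.integrable_of_hasCompactSupport hφ.hasCompactSupport

lemma deriv (hφ : IsBumpOn a b φ) : IsBumpOn a b (deriv φ) where
  contDiff := (contDiff_infty_iff_deriv.1 hφ.contDiff).2
  hasCompactSupport := hφ.hasCompactSupport.deriv
  tsupport_subset := (tsupport_deriv_subset (𝕜 := ℝ) (f := φ)).trans hφ.tsupport_subset

lemma exists_integral_eq_one (hab : a < b) : ∃ h, IsBumpOn a b h ∧ ∫ t, h t = 1 := by
  let f : ContDiffBump ((a + b) / 2) := ⟨(b - a) / 8, (b - a) / 4, by linarith, by linarith⟩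
  refine ⟨f.normed volume, ⟨f.contDiff_normed, f.hasCompactSupport_normed, ?_⟩,
    f.integral_normed⟩
  rw [f.tsupport_normed_eq, Real.closedBall_eq_Icc]
  intro t ht
  simp only [f, mem_Icc] at ht
  exact ⟨by linarith [ht.1], by linarith [ht.2]⟩

/-- A bump with vanishing mean is the derivative of a bump. -/
lemma exists_primitive (hab : a < b) (hφ : IsBumpOn a b φ) (h0 : ∫ t, φ t = 0) :
    ∃ Φ, IsBumpOn a b Φ ∧ _root_.deriv Φ = φ := by
  obtain ⟨c, d, hac, hdb, hcd⟩ : ∃ c d, a < c ∧ d < b ∧ tsupport φ ⊆ Icc c d := by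
    rcases (tsupport φ).eq_empty_or_nonempty with he | hne
    · exact ⟨(a + b) / 2, (a + b) / 2, by linarith, by linarith, by simp [he]⟩
    · have hc : IsCompact (tsupport φ) := hφ.hasCompactSupport
      exact ⟨sInf (tsupport φ), sSup (tsupport φ),
        (hφ.tsupport_subset (hc.sInf_mem hne)).1, (hφ.tsupport_subset (hc.sSup_mem hne)).2,
        fun t ht => ⟨csInf_le hc.bddBelow ht, le_csSup hc.bddAbove ht⟩⟩
  have hz : ∀ t, t ∉ Icc c d → φ t = 0 := fun t ht =>
    image_eq_zero_of_notMem_tsupport fun h => ht (hcd h)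
  have hd : ∀ t, HasDerivAt (fun x => ∫ s in a..x, φ s) (φ t) t := fun t =>
    hφ.continuous.integral_hasStrictDerivAt a t |>.hasDerivAt
  have hder : _root_.deriv (fun x => ∫ s in a..x, φ s) = φ := funext fun t => (hd t).deriv
  -- The primitive is zero to the left of `c` because `φ` is, and to the right of `d` because it has
  -- already reached the total integral, which is zero.
  have hsupp : Function.support (fun x => ∫ s in a..x, φ s) ⊆ Icc c d := by
    intro t ht
    by_contra hn
    apply ht
    rcases lt_or_ge t c with htc | htc
    · have : ∀ s ∈ uIcc a t, φ s = 0 := fun s hs => hz s fun h => by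
        have := (hs.2.trans_lt (max_lt hac htc)); linarith [h.1]
      change ∫ s in a..t, φ s = 0
      rw [intervalIntegral.integral_congr (g := fun _ => (0 : ℝ)) this]
      simp
    · have htd : d < t := not_le.1 fun h => hn ⟨htc, h⟩
      change ∫ s in a..t, φ s = 0
      rw [intervalIntegral.integral_of_le (hac.le.trans htc), ← h0]
      refine setIntegral_eq_integral_of_forall_compl_eq_zero fun s hs => hz s fun h => hs ?_
      exact ⟨hac.trans_le h.1, h.2.trans htd.le⟩
  have hts : tsupport (fun x => ∫ s in a..x, φ s) ⊆ Icc c d :=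
    closure_minimal hsupp isClosed_Icc
  refine ⟨_, ⟨contDiff_infty_iff_deriv.2 ⟨fun t => (hd t).differentiableAt, ?_⟩,
    HasCompactSupport.of_support_subset_isCompact isCompact_Icc hsupp,
    hts.trans (Icc_subset_Ioo hac hdb)⟩, hder⟩
  rw [hder]
  exact hφ.contDiff

end IsBumpOn

/-- The fundamental lemma of the calculus of variations on an interval. -/
lemma ae_eq_zero_of_forall_bump {a b : ℝ} {f : ℝ → ℝ} (hf : IntegrableOn f (Ioo a b))
    (h : ∀ φ, IsBumpOn a b φ → ∫ t in Ioo a b, f t * φ t = 0) :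
    f =ᵐ[volume.restrict (Ioo a b)] 0 := by
  have := isOpen_Ioo.ae_eq_zero_of_integral_contDiff_smul_eq_zero
    (μ := volume) hf.locallyIntegrableOn fun φ h1 h2 h3 => by
      have hφ : IsBumpOn a b φ := ⟨h1, h2, h3⟩
      rw [← h φ hφ, hφ.setIntegral_mul]
      simp [mul_comm]
  exact (ae_restrict_iff' measurableSet_Ioo).2 this

/-- Continuity upgrades almost everywhere to everywhere, end points included. The end points matter:
the gap is read off on the edges of the closed plate. -/
lemma eqOn_zero_of_forall_bump {a b : ℝ} (hab : a < b) {f : ℝ → ℝ}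
    (hf : ContinuousOn f (Icc a b))
    (h : ∀ φ, IsBumpOn a b φ → ∫ t in Ioo a b, f t * φ t = 0) :
    ∀ t ∈ Icc a b, f t = 0 := by
  have h1 := ae_eq_zero_of_forall_bump
    ((hf.integrableOn_compact isCompact_Icc).mono_set Ioo_subset_Icc_self) h
  rw [Measure.restrict_congr_set Ioo_ae_eq_Icc] at h1
  exact Measure.eqOn_Icc_of_ae_eq volume hab.ne h1 hf continuousOn_const

/-- `g` is the weak derivative of `V` on `(a, b)`. -/
structure IsWeakDerivOn (a b : ℝ) (V g : ℝ → ℝ) : Prop where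
  integrableOn : IntegrableOn V (Ioo a b)
  integrableOn_deriv : IntegrableOn g (Ioo a b)
  integral_eq : ∀ φ, IsBumpOn a b φ →
    ∫ t in Ioo a b, V t * deriv φ t = - ∫ t in Ioo a b, g t * φ t

lemma intervalIntegrable_of_Ioo {a b : ℝ} (hab : a ≤ b) {g : ℝ → ℝ}
    (hg : IntegrableOn g (Ioo a b)) : IntervalIntegrable g volume a b :=
  (intervalIntegrable_iff_integrableOn_Ioo_of_le hab).2 hg

lemma setIntegral_Ioo_eq {a b : ℝ} (hab : a ≤ b) (f : ℝ → ℝ) :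
    ∫ t in Ioo a b, f t = ∫ t in a..b, f t := by
  rw [intervalIntegral.integral_of_le hab, integral_Ioc_eq_integral_Ioo]

/-- Integration by parts for a primitive of an integrable function. -/
lemma integral_mul_eq_of_primitive {a b : ℝ} (hab : a ≤ b) {g ψ : ℝ → ℝ}
    (hg : IntegrableOn g (Ioo a b)) (hψ : ContDiff ℝ 1 ψ) (c : ℝ) :
    ∫ t in Ioo a b, g t * ψ t = (c + ∫ s in a..b, g s) * ψ b - c * ψ a
      - ∫ t in Ioo a b, (c + ∫ s in a..t, g s) * deriv ψ t := by
  have hgi := intervalIntegrable_of_Ioo hab hg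
  set G : ℝ → ℝ := fun t => c + ∫ s in a..t, g s with hG
  have hac : AbsolutelyContinuousOnInterval G a b :=
    (LipschitzOnWith.absolutelyContinuousOnInterval (f := fun _ => c) (K := 0)
      (LipschitzWith.const c).lipschitzOnWith).add
      (hgi.absolutelyContinuousOnInterval_intervalIntegral left_mem_uIcc)
  have hψac : AbsolutelyContinuousOnInterval ψ a b :=
    hψ.contDiffOn.absolutelyContinuousOnInterval
  have key := hac.integral_mul_deriv_eq_deriv_mul hψac
  -- The primitive has derivative `g` only almost everywhere, hence the detour through absolute
  -- continuity.
  have hae : ∫ t in a..b, deriv G t * ψ t = ∫ t in a..b, g t * ψ t := by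
    apply intervalIntegral.integral_congr_ae
    filter_upwards [hgi.ae_hasDerivAt_integral] with t ht htm
    have := (ht (uIoc_subset_uIcc htm) a left_mem_uIcc).const_add c
    rw [this.deriv]
  rw [setIntegral_Ioo_eq hab, setIntegral_Ioo_eq hab, key, hae]
  simp [hG]

/-- The lemma of du Bois-Reymond. -/
lemma IsWeakDerivOn.exists_ae_eq {a b : ℝ} (hab : a < b) {V g : ℝ → ℝ}
    (h : IsWeakDerivOn a b V g) :
    ∃ c, V =ᵐ[volume.restrict (Ioo a b)] fun t => c + ∫ s in a..t, g s := by
  obtain ⟨η, hη, hη1⟩ := IsBumpOn.exists_integral_eq_one hab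
  have hgi := intervalIntegrable_of_Ioo hab.le h.integrableOn_deriv
  have hGc : ContinuousOn (fun t => ∫ s in a..t, g s) (Icc a b) := by
    have := intervalIntegral.continuousOn_primitive_interval' hgi left_mem_uIcc
    rwa [uIcc_of_le hab.le] at this
  have hGi : IntegrableOn (fun t => ∫ s in a..t, g s) (Ioo a b) :=
    (hGc.integrableOn_compact isCompact_Icc).mono_set Ioo_subset_Icc_self
  set W : ℝ → ℝ := fun t => V t - ∫ s in a..t, g s with hW
  have hWi : IntegrableOn W (Ioo a b) := h.integrableOn.sub hGi
  have hmul : ∀ {f φ : ℝ → ℝ}, IntegrableOn f (Ioo a b) → IsBumpOn a b φ →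
      IntegrableOn (fun t => f t * φ t) (Ioo a b) := fun {f φ} hf hφ => by
    obtain ⟨C, hC⟩ := hφ.hasCompactSupport.exists_bound_of_continuous hφ.continuous
    exact hf.mul_bdd hφ.continuous.aestronglyMeasurable (Eventually.of_forall hC)
  have hW0 : ∀ Φ, IsBumpOn a b Φ → ∫ t in Ioo a b, W t * deriv Φ t = 0 := fun Φ hΦ => by
    have h1 := h.integral_eq Φ hΦ
    have h2 := integral_mul_eq_of_primitive hab.le h.integrableOn_deriv
      (hΦ.contDiff.of_le (by simp)) 0
    rw [hΦ.eq_zero_of_notMem (t := a) (by simp), hΦ.eq_zero_of_notMem (t := b) (by simp)] at h2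
    simp only [zero_add, mul_zero, sub_zero, zero_sub] at h2
    simp only [hW, sub_mul]
    rw [integral_sub (hmul h.integrableOn hΦ.deriv) (hmul hGi hΦ.deriv), h1, h2]
    ring
  set c := ∫ t in Ioo a b, W t * η t with hc
  refine ⟨c, ?_⟩
  have hcW : IntegrableOn (fun t => W t - c) (Ioo a b) := hWi.sub (integrableOn_const (by simp))
  -- Subtracting `m η` from `φ` makes the mean zero, so the difference is the derivative of a bump
  -- and is orthogonal to `W`. Hence `∫ W φ = m ∫ W η = c ∫ φ`.
  have := ae_eq_zero_of_forall_bump hcW fun φ hφ => by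
    set m := ∫ t, φ t with hm
    have hb : IsBumpOn a b (fun t => φ t - m * η t) :=
      ⟨hφ.contDiff.sub (contDiff_const.mul hη.contDiff),
        hφ.hasCompactSupport.sub hη.hasCompactSupport.mul_left,
        (tsupport_sub φ _).trans (union_subset hφ.tsupport_subset
          ((tsupport_mul_subset_right).trans hη.tsupport_subset))⟩
    obtain ⟨Φ, hΦ, hd⟩ := hb.exists_primitive hab (by
      rw [integral_sub hφ.integrable (hη.integrable.const_mul m), integral_const_mul, hη1, hm]
      ring)
    have h0 := hW0 Φ hΦ
    rw [hd] at h0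
    have e1 : ∀ t, W t * (φ t - m * η t) = W t * φ t - m * (W t * η t) := fun t => by ring
    simp only [e1] at h0
    rw [integral_sub (hmul hWi hφ) ((hmul hWi hη).const_mul m), integral_const_mul] at h0
    have e2 : ∀ t, (W t - c) * φ t = W t * φ t - c * φ t := fun t => by ring
    simp only [e2]
    have hm' : ∫ t in Ioo a b, φ t = m := by
      have := hφ.setIntegral_mul (fun _ => 1)
      simpa using this
    rw [integral_sub (hmul hWi hφ) (hφ.integrable.integrableOn.const_mul c), integral_const_mul,
      hm']
    linarith
  filter_upwards [this] with t ht
  simp only [hW, Pi.zero_apply] at ht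
  linarith

/-- Integration by parts against a `C¹` function vanishing at the end points. -/
lemma IsWeakDerivOn.integral_mul_of_eq_zero {a b : ℝ} (hab : a < b) {V g ψ : ℝ → ℝ}
    (h : IsWeakDerivOn a b V g) (hψ : ContDiff ℝ 1 ψ) (ha : ψ a = 0) (hb : ψ b = 0) :
    ∫ t in Ioo a b, g t * ψ t = - ∫ t in Ioo a b, V t * deriv ψ t := by
  obtain ⟨c, hc⟩ := h.exists_ae_eq hab
  rw [integral_mul_eq_of_primitive hab.le h.integrableOn_deriv hψ c, ha, hb]
  have : ∫ t in Ioo a b, V t * deriv ψ t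
      = ∫ t in Ioo a b, (c + ∫ s in a..t, g s) * deriv ψ t :=
    integral_congr_ae (hc.mono fun t ht => by simp only [ht])
  rw [this]
  ring

/-- Integration by parts, with boundary terms, for a continuous function. -/
lemma IsWeakDerivOn.integral_mul {a b : ℝ} (hab : a < b) {V g ψ : ℝ → ℝ}
    (h : IsWeakDerivOn a b V g) (hV : ContinuousOn V (Icc a b)) (hψ : ContDiff ℝ 1 ψ) :
    ∫ t in Ioo a b, g t * ψ t = V b * ψ b - V a * ψ a - ∫ t in Ioo a b, V t * deriv ψ t := by
  obtain ⟨c, hc⟩ := h.exists_ae_eq hab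
  have hgi := intervalIntegrable_of_Ioo hab.le h.integrableOn_deriv
  have hGc : ContinuousOn (fun t => c + ∫ s in a..t, g s) (Icc a b) := by
    have := intervalIntegral.continuousOn_primitive_interval' hgi left_mem_uIcc
    rw [uIcc_of_le hab.le] at this
    exact continuousOn_const.add this
  have hc' := hc
  rw [Measure.restrict_congr_set Ioo_ae_eq_Icc] at hc'
  have heq := Measure.eqOn_Icc_of_ae_eq volume hab.ne hc' hV hGc
  rw [integral_mul_eq_of_primitive hab.le h.integrableOn_deriv hψ c,
    heq (left_mem_Icc.2 hab.le), heq (right_mem_Icc.2 hab.le)]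
  have : ∫ t in Ioo a b, V t * deriv ψ t
      = ∫ t in Ioo a b, (c + ∫ s in a..t, g s) * deriv ψ t :=
    integral_congr_ae (hc.mono fun t ht => by simp only [ht])
  rw [this]
  simp

/-! ### Weak derivatives on a rectangle, tested on products `k(x) n(y)`. -/

section Rectangle

variable {a b c d : ℝ}

lemma MeasureTheory.IntegrableOn.mul_continuous_rect {F K : ℝ × ℝ → ℝ}
    (hF : IntegrableOn F (Ioo a b ×ˢ Ioo c d)) (hK : Continuous K) :
    IntegrableOn (fun p => F p * K p) (Ioo a b ×ˢ Ioo c d) :=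
  hF.mul_continuousOn_of_subset hK.continuousOn (measurableSet_Ioo.prod measurableSet_Ioo)
    (isCompact_Icc.prod isCompact_Icc) (prod_mono Ioo_subset_Icc_self Ioo_subset_Icc_self)

lemma restrict_rect : (volume : Measure (ℝ × ℝ)).restrict (Ioo a b ×ˢ Ioo c d)
    = (volume.restrict (Ioo a b)).prod (volume.restrict (Ioo c d)) := by
  rw [Measure.prod_restrict, Measure.volume_eq_prod]

lemma setIntegral_rect {F : ℝ × ℝ → ℝ} (hF : IntegrableOn F (Ioo a b ×ˢ Ioo c d)) :
    ∫ p in Ioo a b ×ˢ Ioo c d, F p = ∫ x in Ioo a b, ∫ y in Ioo c d, F (x, y) := by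
  rw [IntegrableOn, restrict_rect] at hF
  rw [restrict_rect, integral_prod _ hF]

lemma setIntegral_rect_symm {F : ℝ × ℝ → ℝ} (hF : IntegrableOn F (Ioo a b ×ˢ Ioo c d)) :
    ∫ p in Ioo a b ×ˢ Ioo c d, F p = ∫ y in Ioo c d, ∫ x in Ioo a b, F (x, y) := by
  rw [IntegrableOn, restrict_rect] at hF
  rw [restrict_rect, integral_prod_symm _ hF]

/-- If `F` is orthogonal to all bumps in `y`, it is orthogonal to all continuous functions of
`y`. -/
lemma setIntegral_mul_snd_eq_zero {F : ℝ × ℝ → ℝ} (hF : IntegrableOn F (Ioo a b ×ˢ Ioo c d))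
    (h : ∀ n, IsBumpOn c d n → ∫ p in Ioo a b ×ˢ Ioo c d, F p * n p.2 = 0)
    {n : ℝ → ℝ} (hn : Continuous n) : ∫ p in Ioo a b ×ˢ Ioo c d, F p * n p.2 = 0 := by
  have key : ∀ {n : ℝ → ℝ}, Continuous n → ∫ p in Ioo a b ×ˢ Ioo c d, F p * n p.2
      = ∫ y in Ioo c d, (∫ x in Ioo a b, F (x, y)) * n y := fun {n} hn => by
    rw [setIntegral_rect_symm
      (hF.mul_continuous_rect (by fun_prop : Continuous fun p : ℝ × ℝ => n p.2))]
    simp only [integral_mul_const]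
  have hF' := hF
  rw [IntegrableOn, restrict_rect] at hF'
  have h0 := ae_eq_zero_of_forall_bump (f := fun y => ∫ x in Ioo a b, F (x, y))
    hF'.integral_prod_right fun n hn => by rw [← key hn.continuous, h n hn]
  rw [key hn, integral_congr_ae (g := fun _ => (0 : ℝ))
    (h0.mono fun y hy => by simp only [hy, Pi.zero_apply, zero_mul])]
  simp

lemma partialX_mul {g g' h : ℝ → ℝ} (hg : ∀ x, HasDerivAt g (g' x) x) (hh : Differentiable ℝ h) :
    partialX (fun p => g p.1 * h p.2) = fun p => g' p.1 * h p.2 := by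
  funext p
  have h1 : HasFDerivAt (fun p : ℝ × ℝ => g p.1) _ p :=
    (hg p.1).hasFDerivAt.comp p hasFDerivAt_fst
  have h2 : HasFDerivAt (fun p : ℝ × ℝ => h p.2) _ p :=
    (hh p.2).hasDerivAt.hasFDerivAt.comp p hasFDerivAt_snd
  rw [partialX, (h1.fun_mul h2).fderiv]
  simp [mul_comm]

lemma partialY_mul {g h h' : ℝ → ℝ} (hg : Differentiable ℝ g) (hh : ∀ y, HasDerivAt h (h' y) y) :
    partialY (fun p => g p.1 * h p.2) = fun p => g p.1 * h' p.2 := by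
  funext p
  have h1 : HasFDerivAt (fun p : ℝ × ℝ => g p.1) _ p :=
    (hg p.1).hasDerivAt.hasFDerivAt.comp p hasFDerivAt_fst
  have h2 : HasFDerivAt (fun p : ℝ × ℝ => h p.2) _ p :=
    (hh p.2).hasFDerivAt.comp p hasFDerivAt_snd
  rw [partialY, (h1.fun_mul h2).fderiv]
  simp [mul_comm]

lemma IsBumpOn.hasDerivAt {φ : ℝ → ℝ} (hφ : IsBumpOn a b φ) (x : ℝ) :
    HasDerivAt φ (_root_.deriv φ x) x :=
  (hφ.contDiff.differentiable (by simp) x).hasDerivAt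

lemma IsBumpOn.isTestFunction {χ n : ℝ → ℝ} (hχ : IsBumpOn a b χ) (hn : IsBumpOn c d n) :
    IsTestFunction (Ioo a b ×ˢ Ioo c d) (fun p => χ p.1 * n p.2) := by
  have hs : Function.support (fun p : ℝ × ℝ => χ p.1 * n p.2) ⊆ tsupport χ ×ˢ tsupport n := by
    intro p hp
    exact ⟨subset_tsupport _ (left_ne_zero_of_mul hp), subset_tsupport _ (right_ne_zero_of_mul hp)⟩
  have hc : IsCompact (tsupport χ ×ˢ tsupport n) := hχ.hasCompactSupport.prod hn.hasCompactSupport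
  exact ⟨(hχ.contDiff.comp contDiff_fst).mul (hn.contDiff.comp contDiff_snd),
    HasCompactSupport.of_support_subset_isCompact hc hs,
    (closure_minimal hs hc.isClosed).trans (prod_mono hχ.tsupport_subset hn.tsupport_subset)⟩

/-- The weighted integral of `F` over the vertical slice at `x`. -/
noncomputable def slice (c d : ℝ) (F : ℝ × ℝ → ℝ) (n : ℝ → ℝ) (x : ℝ) : ℝ :=
  ∫ y in Ioo c d, F (x, y) * n y

lemma integrableOn_slice {F : ℝ × ℝ → ℝ} (hF : IntegrableOn F (Ioo a b ×ˢ Ioo c d)) {n : ℝ → ℝ}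
    (hn : Continuous n) : IntegrableOn (slice c d F n) (Ioo a b) := by
  have := hF.mul_continuous_rect (hn.comp continuous_snd)
  rw [IntegrableOn, restrict_rect] at this
  exact this.integral_prod_left

lemma setIntegral_mul_mul {F : ℝ × ℝ → ℝ} (hF : IntegrableOn F (Ioo a b ×ˢ Ioo c d))
    {k n : ℝ → ℝ} (hk : Continuous k) (hn : Continuous n) :
    ∫ p in Ioo a b ×ˢ Ioo c d, F p * (k p.1 * n p.2) = ∫ x in Ioo a b, slice c d F n x * k x := by
  rw [setIntegral_rect (hF.mul_continuous_rect
    (by fun_prop : Continuous fun p : ℝ × ℝ => k p.1 * n p.2))]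
  refine integral_congr_ae (Eventually.of_forall fun x => ?_)
  simp only [slice, ← integral_mul_const]
  congr 1
  funext y
  ring

lemma continuousOn_slice {v : ℝ × ℝ → ℝ} (hv : ContinuousOn v (Icc a b ×ˢ Icc c d)) {n : ℝ → ℝ}
    (hn : Continuous n) : ContinuousOn (slice c d v n) (Icc a b) := by
  have hvn : ContinuousOn (fun p : ℝ × ℝ => v p * n p.2) (Icc a b ×ˢ Icc c d) :=
    hv.mul (hn.comp continuous_snd).continuousOn
  obtain ⟨C, hC⟩ := (isCompact_Icc.prod isCompact_Icc).exists_bound_of_continuousOn hvn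
  refine continuousOn_of_dominated (bound := fun _ => C) (fun x hx => ?_) (fun x hx => ?_)
    (integrable_const C) ?_
  · refine ContinuousOn.aestronglyMeasurable ?_ measurableSet_Ioo
    exact hvn.comp (by fun_prop : ContinuousOn (fun y : ℝ => (x, y)) (Ioo c d))
      fun y hy => ⟨hx, Ioo_subset_Icc_self hy⟩
  · exact (ae_restrict_iff' measurableSet_Ioo).2
      (Eventually.of_forall fun y hy => hC (x, y) ⟨hx, Ioo_subset_Icc_self hy⟩)
  · exact (ae_restrict_iff' measurableSet_Ioo).2
      (Eventually.of_forall fun y hy => hvn.comp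
        (by fun_prop : ContinuousOn (fun x : ℝ => (x, y)) (Icc a b))
        fun x hx => ⟨hx, Ioo_subset_Icc_self hy⟩)

/-- Integrating a weak derivative in `x` over vertical slices. -/
lemma IsWeakPartialX.isWeakDerivOn_slice {p q : ℝ × ℝ → ℝ}
    (h : IsWeakPartialX (Ioo a b ×ˢ Ioo c d) p q)
    (hp : IntegrableOn p (Ioo a b ×ˢ Ioo c d)) (hq : IntegrableOn q (Ioo a b ×ˢ Ioo c d))
    {n : ℝ → ℝ} (hn : Continuous n) : IsWeakDerivOn a b (slice c d p n) (slice c d q n) := by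
  refine ⟨integrableOn_slice hp hn, integrableOn_slice hq hn, fun χ hχ => ?_⟩
  have i1 : IntegrableOn (fun z => p z * deriv χ z.1) (Ioo a b ×ˢ Ioo c d) :=
    hp.mul_continuous_rect (hχ.deriv.continuous.comp continuous_fst)
  have i2 : IntegrableOn (fun z => q z * χ z.1) (Ioo a b ×ˢ Ioo c d) :=
    hq.mul_continuous_rect (hχ.continuous.comp continuous_fst)
  have split : ∀ {m : ℝ → ℝ}, Continuous m →
      ∫ z in Ioo a b ×ˢ Ioo c d, (p z * deriv χ z.1 + q z * χ z.1) * m z.2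
        = (∫ z in Ioo a b ×ˢ Ioo c d, p z * (deriv χ z.1 * m z.2))
          + ∫ z in Ioo a b ×ˢ Ioo c d, q z * (χ z.1 * m z.2) := fun {m} hm => by
    rw [← integral_add]
    · congr 1
      funext z
      ring
    · exact hp.mul_continuous_rect ((hχ.deriv.continuous.comp continuous_fst).mul
        (hm.comp continuous_snd))
    · exact hq.mul_continuous_rect ((hχ.continuous.comp continuous_fst).mul
        (hm.comp continuous_snd))
  -- A product of two bumps is a test function, which settles bumps `m`. No derivative falls on `m`,
  -- so the identity extends to every continuous factor in `y`.
  have := setIntegral_mul_snd_eq_zero (i1.add i2) (fun m hm => by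
    have ht := h _ (hχ.isTestFunction hm)
    rw [partialX_mul hχ.hasDerivAt (hm.contDiff.differentiable (by simp))] at ht
    have := split hm.continuous
    simp only [Pi.add_apply]
    rw [this, ht]
    ring) hn
  simp only [Pi.add_apply] at this
  rw [split hn, setIntegral_mul_mul hp hχ.deriv.continuous hn,
    setIntegral_mul_mul hq hχ.continuous hn] at this
  linarith

lemma IsWeakPartialX.integral_mul_of_eq_zero (hab : a < b) {p q : ℝ × ℝ → ℝ}
    (h : IsWeakPartialX (Ioo a b ×ˢ Ioo c d) p q)
    (hp : IntegrableOn p (Ioo a b ×ˢ Ioo c d)) (hq : IntegrableOn q (Ioo a b ×ˢ Ioo c d))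
    {k n : ℝ → ℝ} (hk : ContDiff ℝ 1 k) (ha : k a = 0) (hb : k b = 0) (hn : Continuous n) :
    ∫ z in Ioo a b ×ˢ Ioo c d, q z * (k z.1 * n z.2)
      = - ∫ z in Ioo a b ×ˢ Ioo c d, p z * (deriv k z.1 * n z.2) := by
  rw [setIntegral_mul_mul hq hk.continuous hn,
    setIntegral_mul_mul hp hk.continuous_deriv_one hn]
  exact (h.isWeakDerivOn_slice hp hq hn).integral_mul_of_eq_zero hab hk ha hb

lemma IsWeakPartialX.integral_mul (hab : a < b) {p q : ℝ × ℝ → ℝ}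
    (h : IsWeakPartialX (Ioo a b ×ˢ Ioo c d) p q)
    (hp : ContinuousOn p (Icc a b ×ˢ Icc c d)) (hq : IntegrableOn q (Ioo a b ×ˢ Ioo c d))
    {k n : ℝ → ℝ} (hk : ContDiff ℝ 1 k) (hn : Continuous n) :
    ∫ z in Ioo a b ×ˢ Ioo c d, q z * (k z.1 * n z.2)
      = slice c d p n b * k b - slice c d p n a * k a
        - ∫ z in Ioo a b ×ˢ Ioo c d, p z * (deriv k z.1 * n z.2) := by
  have hpi : IntegrableOn p (Ioo a b ×ˢ Ioo c d) :=
    (hp.integrableOn_compact (isCompact_Icc.prod isCompact_Icc)).mono_set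
      (prod_mono Ioo_subset_Icc_self Ioo_subset_Icc_self)
  rw [setIntegral_mul_mul hq hk.continuous hn,
    setIntegral_mul_mul hpi hk.continuous_deriv_one hn]
  exact (h.isWeakDerivOn_slice hpi hq hn).integral_mul hab (continuousOn_slice hp hn) hk

lemma setIntegral_rect_swap (F : ℝ × ℝ → ℝ) :
    ∫ z in Ioo c d ×ˢ Ioo a b, F z.swap = ∫ z in Ioo a b ×ˢ Ioo c d, F z :=
  setIntegral_prod_swap (Ioo a b) (Ioo c d) F

lemma MeasureTheory.IntegrableOn.rect_swap {F : ℝ × ℝ → ℝ} (hF : IntegrableOn F (Ioo a b ×ˢ Ioo c d)) :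
    IntegrableOn (fun z => F z.swap) (Ioo c d ×ˢ Ioo a b) := by
  rw [IntegrableOn, restrict_rect] at hF ⊢
  exact hF.swap

/-- Exchanging the coordinates lets the results for the `x` direction serve for the `y` direction
too. -/
lemma IsWeakPartialY.swap {p q : ℝ × ℝ → ℝ} (h : IsWeakPartialY (Ioo a b ×ˢ Ioo c d) p q) :
    IsWeakPartialX (Ioo c d ×ˢ Ioo a b) (fun z => p z.swap) (fun z => q z.swap) := by
  intro φ hφ
  have hts : tsupport (φ ∘ Prod.swap) = Prod.swap ⁻¹' tsupport φ :=
    tsupport_comp_eq_preimage φ (Homeomorph.prodComm ℝ ℝ)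
  have ht : IsTestFunction (Ioo a b ×ˢ Ioo c d) (φ ∘ Prod.swap) := by
    refine ⟨hφ.contDiff.comp (contDiff_snd.prodMk contDiff_fst),
      hφ.hasCompactSupport.comp_homeomorph (Homeomorph.prodComm ℝ ℝ), ?_⟩
    rw [hts]
    intro z hz
    have := hφ.tsupport_subset hz
    exact ⟨this.2, this.1⟩
  have hpd : ∀ z, partialY (φ ∘ Prod.swap) z = partialX φ z.swap := fun z => by
    have h1 : HasFDerivAt φ (fderiv ℝ φ z.swap) z.swap :=
      (hφ.contDiff.differentiable (by simp) _).hasFDerivAt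
    have h2 : HasFDerivAt (Prod.swap : ℝ × ℝ → ℝ × ℝ)
        ((ContinuousLinearMap.snd ℝ ℝ ℝ).prod (ContinuousLinearMap.fst ℝ ℝ ℝ)) z :=
      hasFDerivAt_snd.prodMk hasFDerivAt_fst
    rw [partialY, (h1.comp z h2).fderiv, partialX]
    simp
  have key := h _ ht
  rw [← setIntegral_rect_swap, ← setIntegral_rect_swap (fun z => q z * _)] at key
  simpa [hpd] using key

lemma IsWeakPartialY.integral_mul_of_eq_zero (hcd : c < d) {p q : ℝ × ℝ → ℝ}
    (h : IsWeakPartialY (Ioo a b ×ˢ Ioo c d) p q)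
    (hp : IntegrableOn p (Ioo a b ×ˢ Ioo c d)) (hq : IntegrableOn q (Ioo a b ×ˢ Ioo c d))
    {k n : ℝ → ℝ} (hk : Continuous k) (hn : ContDiff ℝ 1 n) (hc : n c = 0) (hd : n d = 0) :
    ∫ z in Ioo a b ×ˢ Ioo c d, q z * (k z.1 * n z.2)
      = - ∫ z in Ioo a b ×ˢ Ioo c d, p z * (k z.1 * deriv n z.2) := by
  have := h.swap.integral_mul_of_eq_zero hcd hp.rect_swap hq.rect_swap hn hc hd hk
  rw [← setIntegral_rect_swap, ← setIntegral_rect_swap (fun z => p z * _)]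
  simpa [mul_comm] using this

end Rectangle

/-! ### Integration by parts in `H²_*`. -/

namespace H2Star

variable {ℓ : ℝ}

lemma _root_.IsL2On.integrableOn {g : ℝ × ℝ → ℝ} (hg : IsL2On (plate ℓ) g) :
    IntegrableOn g (plate ℓ) := by
  have : IsFiniteMeasure ((volume : Measure (ℝ × ℝ)).restrict (plate ℓ)) := by
    rw [plate, restrict_rect]
    infer_instance
  exact MemLp.integrable (by norm_num) hg

lemma integrableOn_toFun (v : H2Star ℓ) : IntegrableOn v.toFun (plate ℓ) :=
  (v.continuousOn.integrableOn_compact (isCompact_Icc.prod isCompact_Icc)).mono_set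
    (prod_mono Ioo_subset_Icc_self Ioo_subset_Icc_self)

lemma slice_left (v : H2Star ℓ) (n : ℝ → ℝ) : slice (-ℓ) ℓ v.toFun n 0 = 0 := by
  rw [slice, setIntegral_congr_fun measurableSet_Ioo (g := fun _ => (0 : ℝ)) fun y hy => by
    simp only [v.left_eq_zero y (Ioo_subset_Icc_self hy), zero_mul]]
  simp

lemma slice_right (v : H2Star ℓ) (n : ℝ → ℝ) : slice (-ℓ) ℓ v.toFun n Real.pi = 0 := by
  rw [slice, setIntegral_congr_fun measurableSet_Ioo (g := fun _ => (0 : ℝ)) fun y hy => by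
    simp only [v.right_eq_zero y (Ioo_subset_Icc_self hy), zero_mul]]
  simp

/-- No boundary terms arise in `x`, since elements of `H²_*` vanish on the hinged sides. -/
lemma integral_dx_mul (v : H2Star ℓ) {k n : ℝ → ℝ} (hk : ContDiff ℝ 1 k) (hn : Continuous n) :
    ∫ z in plate ℓ, v.dx z * (k z.1 * n z.2)
      = - ∫ z in plate ℓ, v.toFun z * (deriv k z.1 * n z.2) := by
  have := v.weak_dx.integral_mul Real.pi_pos v.continuousOn v.memL2_dx.integrableOn hk hn
  rw [slice_left, slice_right] at this
  simpa [plate] using this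

/-- The two integrations by parts lose their boundary terms for different reasons: in the first `k`
vanishes at `0` and `π`, in the second the element of `H²_*` does. Hence nothing is asked of `k'` at
the end points. -/
lemma integral_dxx_mul (v : H2Star ℓ) {k k' k'' n : ℝ → ℝ} (hk : ∀ x, HasDerivAt k (k' x) x)
    (hk' : ∀ x, HasDerivAt k' (k'' x) x) (hk'' : Continuous k'') (h0 : k 0 = 0)
    (hπ : k Real.pi = 0) (hn : Continuous n) :
    ∫ z in plate ℓ, v.dxx z * (k z.1 * n z.2)
      = ∫ z in plate ℓ, v.toFun z * (k'' z.1 * n z.2) := by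
  have e : deriv k = k' := funext fun x => (hk x).deriv
  have e' : deriv k' = k'' := funext fun x => (hk' x).deriv
  have c' : ContDiff ℝ 1 k' :=
    contDiff_one_iff_deriv.2 ⟨fun x => (hk' x).differentiableAt, by rwa [e']⟩
  have c0 : ContDiff ℝ 1 k :=
    contDiff_one_iff_deriv.2 ⟨fun x => (hk x).differentiableAt, by rw [e]; exact c'.continuous⟩
  have h1 := v.weak_dxx.integral_mul_of_eq_zero Real.pi_pos v.memL2_dx.integrableOn
    v.memL2_dxx.integrableOn c0 h0 hπ hn
  have h2 := v.integral_dx_mul c' hn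
  rw [e'] at h2
  rw [e] at h1
  rw [plate] at h2 ⊢
  rw [h1, h2, neg_neg]

/-- The mixed derivative, integrated by parts in `x` only. -/
lemma integral_dxy_mul (hℓ : 0 < ℓ) (v : H2Star ℓ) {k n : ℝ → ℝ} (hk : ContDiff ℝ 1 k)
    (hn : Continuous n) :
    ∫ z in plate ℓ, v.dxy z * (k z.1 * n z.2)
      = - ∫ z in plate ℓ, v.dy z * (deriv k z.1 * n z.2) := by
  have hlt : -ℓ < ℓ := by linarith
  have hk' := hk.continuous_deriv_one
  have i1 : IntegrableOn (fun z => v.dxy z * k z.1) (plate ℓ) :=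
    IntegrableOn.mul_continuous_rect v.memL2_dxy.integrableOn (hk.continuous.comp continuous_fst)
  have i2 : IntegrableOn (fun z => v.dy z * deriv k z.1) (plate ℓ) :=
    IntegrableOn.mul_continuous_rect v.memL2_dy.integrableOn (hk'.comp continuous_fst)
  have split : ∀ {m : ℝ → ℝ}, Continuous m →
      ∫ z in plate ℓ, (v.dxy z * k z.1 + v.dy z * deriv k z.1) * m z.2
        = (∫ z in plate ℓ, v.dxy z * (k z.1 * m z.2))
          + ∫ z in plate ℓ, v.dy z * (deriv k z.1 * m z.2) := fun {m} hm => by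
    rw [← integral_add]
    · congr 1
      funext z
      ring
    · exact IntegrableOn.mul_continuous_rect v.memL2_dxy.integrableOn
        ((hk.continuous.comp continuous_fst).mul (hm.comp continuous_snd))
    · exact IntegrableOn.mul_continuous_rect v.memL2_dy.integrableOn
        ((hk'.comp continuous_fst).mul (hm.comp continuous_snd))
  -- For a bump `m` both terms are moved onto `v`: one becomes `∫ v k' m'` through `v_x`, the other
  -- its negative through `v_y`. This is the commutation of the mixed derivatives, and no condition
  -- on `k` is needed because `v` vanishes on the hinged sides.
  have key := setIntegral_mul_snd_eq_zero (i1.add i2) (fun m hm => by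
    have hm1 : ContDiff ℝ 1 m := hm.contDiff.of_le (by simp)
    have e1 := v.weak_dxy.integral_mul_of_eq_zero hlt v.memL2_dx.integrableOn
      v.memL2_dxy.integrableOn hk.continuous hm1
      (hm.eq_zero_of_notMem (by simp)) (hm.eq_zero_of_notMem (by simp))
    have e2 := v.weak_dy.integral_mul_of_eq_zero hlt v.integrableOn_toFun
      v.memL2_dy.integrableOn hk' hm1
      (hm.eq_zero_of_notMem (by simp)) (hm.eq_zero_of_notMem (by simp))
    have e3 := v.integral_dx_mul hk hm.deriv.continuous
    have := split hm.continuous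
    simp only [Pi.add_apply]
    rw [plate] at this e3
    rw [this, e1, e2, e3]
    ring) hn
  simp only [Pi.add_apply] at key
  have hs := split hn
  rw [plate] at hs ⊢
  rw [hs] at key
  linarith

end H2Star

/-! ### The explicit family of profiles in `y`. -/

/-- The functions `c e^{αy} + A cosh y + B sinh y + C y cosh y + D y sinh y`. -/
noncomputable def profile (α c A B C D y : ℝ) : ℝ :=
  c * Real.exp (α * y) + A * Real.cosh y + B * Real.sinh y + C * (y * Real.cosh y)
    + D * (y * Real.sinh y)

/-- The family is stable under differentiation, so higher derivatives of the solution amount to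
updating five coefficients. -/
lemma hasDerivAt_profile (α c A B C D y : ℝ) :
    HasDerivAt (profile α c A B C D) (profile α (c * α) (B + C) (A + D) D C y) y := by
  have h1 : HasDerivAt (fun y => Real.exp (α * y)) (Real.exp (α * y) * (α * 1)) y :=
    ((hasDerivAt_id y).const_mul α).exp
  have h2 := (((((h1.const_mul c).add ((Real.hasDerivAt_cosh y).const_mul A)).add
    ((Real.hasDerivAt_sinh y).const_mul B)).add
    (((hasDerivAt_id y).mul (Real.hasDerivAt_cosh y)).const_mul C)).add
    (((hasDerivAt_id y).mul (Real.hasDerivAt_sinh y)).const_mul D))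
  refine h2.congr_deriv ?_
  simp only [profile, id]
  ring

lemma contDiff_profile (α c A B C D : ℝ) : ContDiff ℝ ∞ (profile α c A B C D) := by
  unfold profile
  fun_prop


/-! ### Smooth functions as elements of `H²_*`. -/

section Smooth

variable {u : ℝ × ℝ → ℝ}

lemma contDiff_partialX (hu : ContDiff ℝ ∞ u) : ContDiff ℝ ∞ (partialX u) :=
  (hu.fderiv_right (m := ∞) (by simp)).clm_apply contDiff_const

lemma contDiff_partialY (hu : ContDiff ℝ ∞ u) : ContDiff ℝ ∞ (partialY u) :=
  (hu.fderiv_right (m := ∞) (by simp)).clm_apply contDiff_const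

/-- Integration by parts of a smooth function against a test function. -/
lemma setIntegral_mul_fderiv_of_isTestFunction {Ω : Set (ℝ × ℝ)} {φ : ℝ × ℝ → ℝ}
    (hu : ContDiff ℝ ∞ u) (hφ : IsTestFunction Ω φ) (e : ℝ × ℝ) :
    ∫ p in Ω, u p * fderiv ℝ φ p e = - ∫ p in Ω, fderiv ℝ u p e * φ p := by
  have hud : Continuous fun p => fderiv ℝ u p e :=
    (hu.continuous_fderiv (by simp)).clm_apply continuous_const
  have hφd : Continuous fun p => fderiv ℝ φ p e :=
    (hφ.contDiff.continuous_fderiv (by simp)).clm_apply continuous_const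
  have hφs : HasCompactSupport fun p => fderiv ℝ φ p e :=
    hφ.hasCompactSupport.fderiv_apply (𝕜 := ℝ) e
  rw [setIntegral_eq_integral_of_forall_compl_eq_zero fun p hp => ?_,
    setIntegral_eq_integral_of_forall_compl_eq_zero fun p hp => ?_]
  · exact integral_mul_fderiv_eq_neg_fderiv_mul_of_integrable
      ((hud.mul hφ.contDiff.continuous).integrable_of_hasCompactSupport
        hφ.hasCompactSupport.mul_left)
      ((hu.continuous.mul hφd).integrable_of_hasCompactSupport hφs.mul_left)
      ((hu.continuous.mul hφ.contDiff.continuous).integrable_of_hasCompactSupport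
        hφ.hasCompactSupport.mul_left)
      (fun p _ => hu.differentiable (by simp) p)
      (fun p _ => hφ.contDiff.differentiable (by simp) p)
  · rw [image_eq_zero_of_notMem_tsupport fun h => hp (hφ.tsupport_subset h), mul_zero]
  · rw [image_eq_zero_of_notMem_tsupport fun h =>
      hp (hφ.tsupport_subset (tsupport_fderiv_apply_subset ℝ e h)), mul_zero]

lemma isWeakPartialX_of_contDiff (Ω : Set (ℝ × ℝ)) (hu : ContDiff ℝ ∞ u) :
    IsWeakPartialX Ω u (partialX u) :=
  fun _ hφ => setIntegral_mul_fderiv_of_isTestFunction hu hφ (1, 0)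

lemma isWeakPartialY_of_contDiff (Ω : Set (ℝ × ℝ)) (hu : ContDiff ℝ ∞ u) :
    IsWeakPartialY Ω u (partialY u) :=
  fun _ hφ => setIntegral_mul_fderiv_of_isTestFunction hu hφ (0, 1)

lemma isL2On_plate_of_continuous (ℓ : ℝ) (hu : Continuous u) : IsL2On (plate ℓ) u := by
  obtain ⟨C, hC⟩ := (isCompact_Icc.prod isCompact_Icc : IsCompact
    (Icc (0 : ℝ) Real.pi ×ˢ Icc (-ℓ) ℓ)).exists_bound_of_continuousOn hu.continuousOn
  have : IsFiniteMeasure ((volume : Measure (ℝ × ℝ)).restrict (plate ℓ)) := by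
    rw [plate, restrict_rect]
    infer_instance
  refine MemLp.of_bound hu.aestronglyMeasurable C ?_
  exact (ae_restrict_iff' (measurableSet_Ioo.prod measurableSet_Ioo)).2
    (Eventually.of_forall fun p hp =>
      hC p (prod_mono Ioo_subset_Icc_self Ioo_subset_Icc_self hp))

/-- A smooth function vanishing on the hinged sides, as an element of `H²_*`. -/
noncomputable def H2Star.ofContDiff (ℓ : ℝ) (hu : ContDiff ℝ ∞ u)
    (h0 : ∀ y, u (0, y) = 0) (hπ : ∀ y, u (Real.pi, y) = 0) : H2Star ℓ where
  toFun := u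
  dx := partialX u
  dy := partialY u
  dxx := partialX (partialX u)
  dxy := partialY (partialX u)
  dyy := partialY (partialY u)
  continuousOn := hu.continuous.continuousOn
  left_eq_zero y _ := h0 y
  right_eq_zero y _ := hπ y
  weak_dx := isWeakPartialX_of_contDiff _ hu
  weak_dy := isWeakPartialY_of_contDiff _ hu
  weak_dxx := isWeakPartialX_of_contDiff _ (contDiff_partialX hu)
  weak_dxy := isWeakPartialY_of_contDiff _ (contDiff_partialX hu)
  weak_dyy := isWeakPartialY_of_contDiff _ (contDiff_partialY hu)
  memL2_dx := isL2On_plate_of_continuous ℓ (contDiff_partialX hu).continuous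
  memL2_dy := isL2On_plate_of_continuous ℓ (contDiff_partialY hu).continuous
  memL2_dxx := isL2On_plate_of_continuous ℓ (contDiff_partialX (contDiff_partialX hu)).continuous
  memL2_dxy := isL2On_plate_of_continuous ℓ (contDiff_partialY (contDiff_partialX hu)).continuous
  memL2_dyy := isL2On_plate_of_continuous ℓ (contDiff_partialY (contDiff_partialY hu)).continuous

end Smooth

/-! ### Separation of variables: `sin x · φ(y)` as weak and classical solution. -/

section SineProduct

variable {ℓ σ : ℝ} {φ φ₁ φ₂ φ₃ φ₄ : ℝ → ℝ}

/-- The element `sin x · φ(y)` of `H²_*`. -/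
noncomputable def H2Star.sinMul (ℓ : ℝ) {φ : ℝ → ℝ} (hφ : ContDiff ℝ ∞ φ) : H2Star ℓ :=
  H2Star.ofContDiff ℓ (u := fun p => Real.sin p.1 * φ p.2)
    ((Real.contDiff_sin.comp contDiff_fst).mul (hφ.comp contDiff_snd))
    (fun y => by simp) (fun y => by simp)

lemma hasDerivAt_neg_sin (x : ℝ) : HasDerivAt (fun x => -Real.sin x) (-Real.cos x) x :=
  (Real.hasDerivAt_sin x).neg

lemma partialX_sin_mul (hφ : Differentiable ℝ φ) :
    partialX (fun p => Real.sin p.1 * φ p.2) = fun p => Real.cos p.1 * φ p.2 :=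
  partialX_mul Real.hasDerivAt_sin hφ

lemma partialX_cos_mul (hφ : Differentiable ℝ φ) :
    partialX (fun p => Real.cos p.1 * φ p.2) = fun p => -Real.sin p.1 * φ p.2 :=
  partialX_mul Real.hasDerivAt_cos hφ

lemma partialX_partialX_sin_mul (hφ : Differentiable ℝ φ) :
    partialX (partialX (fun p => Real.sin p.1 * φ p.2)) = fun p => -Real.sin p.1 * φ p.2 := by
  rw [partialX_sin_mul hφ, partialX_cos_mul hφ]

lemma partialX_four_sin_mul (hφ : Differentiable ℝ φ) :
    partialX (partialX (partialX (partialX (fun p => Real.sin p.1 * φ p.2))))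
      = fun p => Real.sin p.1 * φ p.2 := by
  rw [partialX_partialX_sin_mul hφ, partialX_mul hasDerivAt_neg_sin hφ,
    partialX_mul (g := fun x => -Real.cos x) (fun x => (Real.hasDerivAt_cos x).neg) hφ]
  simp

lemma partialY_sin_mul (h : ∀ y, HasDerivAt φ (φ₁ y) y) :
    partialY (fun p => Real.sin p.1 * φ p.2) = fun p => Real.sin p.1 * φ₁ p.2 :=
  partialY_mul Real.differentiable_sin h

/-- The bilinear form on `sin x · φ(y)`, when `sin x · φ(y)` satisfies the free boundary
conditions. -/
lemma H2Star.scalarProduct_sinMul (hℓ : 0 < ℓ) (hφ : ContDiff ℝ ∞ φ)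
    (d₁ : ∀ y, HasDerivAt φ (φ₁ y) y) (d₂ : ∀ y, HasDerivAt φ₁ (φ₂ y) y)
    (d₃ : ∀ y, HasDerivAt φ₂ (φ₃ y) y) (d₄ : ∀ y, HasDerivAt φ₃ (φ₄ y) y)
    (c₄ : Continuous φ₄)
    (free₂ : ∀ y ∈ ({-ℓ, ℓ} : Set ℝ), φ₂ y - σ * φ y = 0)
    (free₃ : ∀ y ∈ ({-ℓ, ℓ} : Set ℝ), φ₃ y - (2 - σ) * φ₁ y = 0) (v : H2Star ℓ) :
    H2Star.scalarProduct σ (H2Star.sinMul ℓ hφ) v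
      = ∫ p in plate ℓ, (Real.sin p.1 * (φ₄ p.2 - 2 * φ₂ p.2 + φ p.2)) * v.toFun p := by
  have hlt : -ℓ < ℓ := by linarith
  have D₀ : Differentiable ℝ φ := fun y => (d₁ y).differentiableAt
  have D₁ : Differentiable ℝ φ₁ := fun y => (d₂ y).differentiableAt
  have c₀ : Continuous φ := D₀.continuous
  have c₁ : Continuous φ₁ := D₁.continuous
  have c₂ : Continuous φ₂ := continuous_iff_continuousAt.2 fun y => (d₃ y).continuousAt
  have c₃ : Continuous φ₃ := continuous_iff_continuousAt.2 fun y => (d₄ y).continuousAt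
  have hxx : (H2Star.sinMul ℓ hφ).dxx = fun p => -Real.sin p.1 * φ p.2 :=
    partialX_partialX_sin_mul D₀
  have hxy : (H2Star.sinMul ℓ hφ).dxy = fun p => Real.cos p.1 * φ₁ p.2 := by
    change partialY (partialX _) = _
    rw [partialX_sin_mul D₀, partialY_mul Real.differentiable_cos d₁]
  have hyy : (H2Star.sinMul ℓ hφ).dyy = fun p => Real.sin p.1 * φ₂ p.2 := by
    change partialY (partialY _) = _
    rw [partialY_sin_mul d₁, partialY_sin_mul d₂]
  have int : ∀ {F : ℝ × ℝ → ℝ}, IntegrableOn F (plate ℓ) → ∀ {k n : ℝ → ℝ}, Continuous k →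
      Continuous n → IntegrableOn (fun p => F p * (k p.1 * n p.2)) (plate ℓ) :=
    fun {F} hF {k n} hk hn => hF.mul_continuous_rect
      (by fun_prop : Continuous fun p : ℝ × ℝ => k p.1 * n p.2)
  -- integrate by parts the three second order terms
  have exx := v.integral_dxx_mul (n := fun y => σ * φ₂ y - φ y) Real.hasDerivAt_sin
    Real.hasDerivAt_cos (by fun_prop) Real.sin_zero Real.sin_pi (by fun_prop)
  have exy := v.integral_dxy_mul hℓ (k := Real.cos) (n := fun y => 2 * (1 - σ) * φ₁ y)
    Real.contDiff_cos (by fun_prop)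
  have dm : ∀ y, HasDerivAt (fun y => φ₂ y - σ * φ y) (φ₃ y - σ * φ₁ y) y := fun y =>
    (d₃ y).sub ((d₁ y).const_mul σ)
  have edm : deriv (fun y => φ₂ y - σ * φ y) = fun y => φ₃ y - σ * φ₁ y :=
    funext fun y => (dm y).deriv
  -- No boundary values of `v_y` are available; the bending condition `φ'' = σφ` makes the
  -- multiplier vanish on both free edges.
  have eyy := v.weak_dyy.integral_mul_of_eq_zero hlt v.memL2_dy.integrableOn
    v.memL2_dyy.integrableOn Real.continuous_sin (n := fun y => φ₂ y - σ * φ y)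
    (contDiff_one_iff_deriv.2 ⟨fun y => (dm y).differentiableAt, by rw [edm]; fun_prop⟩)
    (free₂ _ (by simp)) (free₂ _ (by simp))
  have dr : ∀ y, HasDerivAt (fun y => φ₃ y - (2 - σ) * φ₁ y) (φ₄ y - (2 - σ) * φ₂ y) y := fun y =>
    (d₄ y).sub ((d₂ y).const_mul _)
  have edr : deriv (fun y => φ₃ y - (2 - σ) * φ₁ y) = fun y => φ₄ y - (2 - σ) * φ₂ y :=
    funext fun y => (dr y).deriv
  have ey := v.weak_dy.integral_mul_of_eq_zero hlt v.integrableOn_toFun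
    v.memL2_dy.integrableOn Real.continuous_sin (n := fun y => φ₃ y - (2 - σ) * φ₁ y)
    (contDiff_one_iff_deriv.2 ⟨fun y => (dr y).differentiableAt, by rw [edr]; fun_prop⟩)
    (free₃ _ (by simp)) (free₃ _ (by simp))
  rw [edm] at eyy
  rw [edr] at ey
  rw [Real.deriv_cos'] at exy
  -- Collecting the form by second derivatives of `v`, the coefficients are `u_xx + σ u_yy`, `2(1-σ)
  -- u_xy` and `u_yy + σ u_xx`.
  have split1 : H2Star.scalarProduct σ (H2Star.sinMul ℓ hφ) v
      = (∫ p in plate ℓ, v.dxx p * (Real.sin p.1 * (σ * φ₂ p.2 - φ p.2)))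
        + (∫ p in plate ℓ, v.dxy p * (Real.cos p.1 * (2 * (1 - σ) * φ₁ p.2)))
        + ∫ p in plate ℓ, v.dyy p * (Real.sin p.1 * (φ₂ p.2 - σ * φ p.2)) := by
    rw [← integral_add, ← integral_add]
    · rw [H2Star.scalarProduct, hxx, hxy, hyy]
      congr 1
      funext p
      ring
    · exact (int v.memL2_dxx.integrableOn Real.continuous_sin
        (n := fun y => σ * φ₂ y - φ y) (by fun_prop)).add
        (int v.memL2_dxy.integrableOn Real.continuous_cos
          (n := fun y => 2 * (1 - σ) * φ₁ y) (by fun_prop))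
    · exact int v.memL2_dyy.integrableOn Real.continuous_sin
        (n := fun y => φ₂ y - σ * φ y) (by fun_prop)
    · exact int v.memL2_dxx.integrableOn Real.continuous_sin
        (n := fun y => σ * φ₂ y - φ y) (by fun_prop)
    · exact int v.memL2_dxy.integrableOn Real.continuous_cos
        (n := fun y => 2 * (1 - σ) * φ₁ y) (by fun_prop)
  -- The mixed term contributes `2(1-σ)φ'`, which turns `φ''' - σφ'` into `φ''' - (2-σ)φ'`. This is
  -- the multiplier that the shear condition annihilates on the free edges.
  have split2 : (- ∫ p in plate ℓ, v.dy p * (-Real.sin p.1 * (2 * (1 - σ) * φ₁ p.2)))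
        + - ∫ p in plate ℓ, v.dy p * (Real.sin p.1 * (φ₃ p.2 - σ * φ₁ p.2))
      = - ∫ p in plate ℓ, v.dy p * (Real.sin p.1 * (φ₃ p.2 - (2 - σ) * φ₁ p.2)) := by
    rw [← neg_add, ← integral_add]
    · congr 2
      funext p
      ring
    · exact int v.memL2_dy.integrableOn Real.continuous_sin.neg
        (n := fun y => 2 * (1 - σ) * φ₁ y) (by fun_prop)
    · exact int v.memL2_dy.integrableOn Real.continuous_sin
        (n := fun y => φ₃ y - σ * φ₁ y) (by fun_prop)
  rw [plate] at *
  rw [split1, exx, exy, eyy, add_assoc, split2, ey, neg_neg, ← integral_add]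
  · congr 1
    funext p
    ring
  · exact int v.integrableOn_toFun Real.continuous_sin.neg
      (n := fun y => σ * φ₂ y - φ y) (by fun_prop)
  · exact int v.integrableOn_toFun Real.continuous_sin
      (n := fun y => φ₄ y - (2 - σ) * φ₂ y) (by fun_prop)

/-- `sin x · φ(y)` solves the boundary value problem when `φ` solves the reduced one. -/
lemma isClassicalSolution_sin_mul {f : ℝ × ℝ → ℝ} (hφ : ContDiff ℝ ∞ φ)
    (d₁ : ∀ y, HasDerivAt φ (φ₁ y) y) (d₂ : ∀ y, HasDerivAt φ₁ (φ₂ y) y)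
    (d₃ : ∀ y, HasDerivAt φ₂ (φ₃ y) y) (d₄ : ∀ y, HasDerivAt φ₃ (φ₄ y) y)
    (hf : ∀ p, Real.sin p.1 * (φ₄ p.2 - 2 * φ₂ p.2 + φ p.2) = f p)
    (free₂ : ∀ y ∈ ({-ℓ, ℓ} : Set ℝ), φ₂ y - σ * φ y = 0)
    (free₃ : ∀ y ∈ ({-ℓ, ℓ} : Set ℝ), φ₃ y - (2 - σ) * φ₁ y = 0) :
    IsClassicalSolution σ ℓ f (fun p => Real.sin p.1 * φ p.2) := by
  have D₀ : Differentiable ℝ φ := fun y => (d₁ y).differentiableAt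
  have hs : Differentiable ℝ fun x => -Real.sin x := Real.differentiable_sin.neg
  have hu : ContDiff ℝ ∞ (fun p : ℝ × ℝ => Real.sin p.1 * φ p.2) :=
    (Real.contDiff_sin.comp contDiff_fst).mul (hφ.comp contDiff_snd)
  refine ⟨by exact_mod_cast contDiff_infty.1 hu 4, fun p _ => ?_, fun x hx y _ => ?_,
    fun x _ y hy => ?_⟩
  · rw [partialX_four_sin_mul D₀, partialX_partialX_sin_mul D₀, partialY_mul hs d₁,
      partialY_mul hs d₂, partialY_sin_mul d₁, partialY_sin_mul d₂, partialY_sin_mul d₃,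
      partialY_sin_mul d₄, ← hf p]
    ring
  · have hx0 : Real.sin x = 0 := by
      rcases hx with rfl | rfl
      exacts [Real.sin_zero, Real.sin_pi]
    rw [partialX_partialX_sin_mul D₀]
    simp [hx0]
  · rw [partialX_partialX_sin_mul D₀, partialY_mul hs d₁, partialY_sin_mul d₁,
      partialY_sin_mul d₂, partialY_sin_mul d₃]
    exact ⟨by linear_combination Real.sin x * free₂ y hy,
      by linear_combination Real.sin x * free₃ y hy⟩

end SineProduct

/-! ### Uniqueness of the weak solution. -/

namespace H2Star

variable {ℓ : ℝ}

lemma _root_.IsWeakPartialX.sub {p q p' q' : ℝ × ℝ → ℝ}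
    (h : IsWeakPartialX (plate ℓ) p q) (h' : IsWeakPartialX (plate ℓ) p' q')
    (hp : IntegrableOn p (plate ℓ)) (hq : IntegrableOn q (plate ℓ))
    (hp' : IntegrableOn p' (plate ℓ)) (hq' : IntegrableOn q' (plate ℓ)) :
    IsWeakPartialX (plate ℓ) (p - p') (q - q') := by
  intro φ hφ
  have c : Continuous φ := hφ.contDiff.continuous
  have c' : Continuous (partialX φ) := (contDiff_partialX hφ.contDiff).continuous
  simp only [Pi.sub_apply, sub_mul]
  unfold plate at *
  rw [integral_sub (hp.mul_continuous_rect c') (hp'.mul_continuous_rect c'),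
    integral_sub (hq.mul_continuous_rect c) (hq'.mul_continuous_rect c), h φ hφ, h' φ hφ]
  ring

lemma _root_.IsWeakPartialY.sub {p q p' q' : ℝ × ℝ → ℝ}
    (h : IsWeakPartialY (plate ℓ) p q) (h' : IsWeakPartialY (plate ℓ) p' q')
    (hp : IntegrableOn p (plate ℓ)) (hq : IntegrableOn q (plate ℓ))
    (hp' : IntegrableOn p' (plate ℓ)) (hq' : IntegrableOn q' (plate ℓ)) :
    IsWeakPartialY (plate ℓ) (p - p') (q - q') := by
  intro φ hφ
  have c : Continuous φ := hφ.contDiff.continuous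
  have c' : Continuous (partialY φ) := (contDiff_partialY hφ.contDiff).continuous
  simp only [Pi.sub_apply, sub_mul]
  unfold plate at *
  rw [integral_sub (hp.mul_continuous_rect c') (hp'.mul_continuous_rect c'),
    integral_sub (hq.mul_continuous_rect c) (hq'.mul_continuous_rect c), h φ hφ, h' φ hφ]
  ring

noncomputable instance : Sub (H2Star ℓ) where
  sub u v :=
    { toFun := u.toFun - v.toFun
      dx := u.dx - v.dx
      dy := u.dy - v.dy
      dxx := u.dxx - v.dxx
      dxy := u.dxy - v.dxy
      dyy := u.dyy - v.dyy
      continuousOn := u.continuousOn.sub v.continuousOn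
      left_eq_zero := fun y hy => by simp [u.left_eq_zero y hy, v.left_eq_zero y hy]
      right_eq_zero := fun y hy => by simp [u.right_eq_zero y hy, v.right_eq_zero y hy]
      weak_dx := u.weak_dx.sub v.weak_dx u.integrableOn_toFun u.memL2_dx.integrableOn
        v.integrableOn_toFun v.memL2_dx.integrableOn
      weak_dy := u.weak_dy.sub v.weak_dy u.integrableOn_toFun u.memL2_dy.integrableOn
        v.integrableOn_toFun v.memL2_dy.integrableOn
      weak_dxx := u.weak_dxx.sub v.weak_dxx u.memL2_dx.integrableOn u.memL2_dxx.integrableOn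
        v.memL2_dx.integrableOn v.memL2_dxx.integrableOn
      weak_dxy := u.weak_dxy.sub v.weak_dxy u.memL2_dx.integrableOn u.memL2_dxy.integrableOn
        v.memL2_dx.integrableOn v.memL2_dxy.integrableOn
      weak_dyy := u.weak_dyy.sub v.weak_dyy u.memL2_dy.integrableOn u.memL2_dyy.integrableOn
        v.memL2_dy.integrableOn v.memL2_dyy.integrableOn
      memL2_dx := u.memL2_dx.sub v.memL2_dx
      memL2_dy := u.memL2_dy.sub v.memL2_dy
      memL2_dxx := u.memL2_dxx.sub v.memL2_dxx
      memL2_dxy := u.memL2_dxy.sub v.memL2_dxy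
      memL2_dyy := u.memL2_dyy.sub v.memL2_dyy }

lemma integrableOn_scalarProduct (σ : ℝ) (u v : H2Star ℓ) :
    IntegrableOn (fun p => (u.dxx p + u.dyy p) * (v.dxx p + v.dyy p)
      + (1 - σ) * (2 * u.dxy p * v.dxy p - u.dxx p * v.dyy p - u.dyy p * v.dxx p))
      (plate ℓ) := by
  have h1 := (u.memL2_dxx.add u.memL2_dyy).integrable_mul (v.memL2_dxx.add v.memL2_dyy)
  have h2 := u.memL2_dxy.integrable_mul v.memL2_dxy
  have h3 := u.memL2_dxx.integrable_mul v.memL2_dyy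
  have h4 := u.memL2_dyy.integrable_mul v.memL2_dxx
  refine (h1.add ((((h2.const_mul 2).sub h3).sub h4).const_mul (1 - σ))).congr
    (Eventually.of_forall fun p => ?_)
  simp only [Pi.add_apply, Pi.sub_apply, Pi.mul_apply]
  ring

lemma scalarProduct_sub_left (σ : ℝ) (u v w : H2Star ℓ) :
    scalarProduct σ (u - v) w = scalarProduct σ u w - scalarProduct σ v w := by
  rw [scalarProduct, scalarProduct, scalarProduct,
    ← integral_sub (integrableOn_scalarProduct σ u w) (integrableOn_scalarProduct σ v w)]
  congr 1
  funext p
  have e1 : (u - v).dxx p = u.dxx p - v.dxx p := rfl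
  have e2 : (u - v).dxy p = u.dxy p - v.dxy p := rfl
  have e3 : (u - v).dyy p = u.dyy p - v.dyy p := rfl
  rw [e1, e2, e3]
  ring

/-- On the diagonal the integrand is `σ(Δw)² + (1-σ)(w_xx² + w_yy² + 2w_xy²)`, a sum of nonnegative
terms when `0 ≤ σ < 1`. Only `w_xx` is recorded because the hinged conditions make it sufficient. -/
lemma dxx_ae_eq_zero {σ : ℝ} (hσ0 : 0 ≤ σ) (hσ1 : σ < 1) (w : H2Star ℓ)
    (hw : scalarProduct σ w w = 0) : w.dxx =ᵐ[volume.restrict (plate ℓ)] 0 := by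
  have hform : ∀ X Y Z : ℝ, (X + Y) * (X + Y) + (1 - σ) * (2 * Z * Z - X * Y - Y * X)
      = σ * (X + Y) ^ 2 + (1 - σ) * (X ^ 2 + Y ^ 2 + 2 * Z ^ 2) := fun X Y Z => by ring
  have h1 : 0 < 1 - σ := by linarith
  have h0 := (integral_eq_zero_iff_of_nonneg (fun p => by
    simp only [hform, Pi.zero_apply]
    positivity) (integrableOn_scalarProduct σ w w)).1 hw
  filter_upwards [h0] with p hp
  simp only [hform, Pi.zero_apply] at hp
  have hs : (1 - σ) * w.dxx p ^ 2 ≤ 0 := by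
    have : 0 ≤ σ * (w.dxx p + w.dyy p) ^ 2 := by positivity
    have : 0 ≤ (1 - σ) * (w.dyy p ^ 2 + 2 * w.dxy p ^ 2) := by positivity
    linarith
  have : w.dxx p ^ 2 ≤ 0 := by
    by_contra! hlt
    linarith [mul_pos h1 hlt]
  exact pow_eq_zero_iff two_ne_zero |>.1 (le_antisymm this (sq_nonneg _))

/-- Integrate twice from `0` and subtract the linear function matching the value at `b`. It solves
the Dirichlet problem `k'' = χ`. -/
lemma _root_.exists_second_primitive {χ : ℝ → ℝ} (hχ : Continuous χ) {b : ℝ} (hb : b ≠ 0) :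
    ∃ k k' : ℝ → ℝ, (∀ x, HasDerivAt k (k' x) x) ∧ (∀ x, HasDerivAt k' (χ x) x) ∧
      k 0 = 0 ∧ k b = 0 := by
  set F : ℝ → ℝ := fun x => ∫ s in (0 : ℝ)..x, χ s with hF
  have dF : ∀ x, HasDerivAt F (χ x) x := fun x => (hχ.integral_hasStrictDerivAt 0 x).hasDerivAt
  have cF : Continuous F := continuous_iff_continuousAt.2 fun x => (dF x).continuousAt
  set G : ℝ → ℝ := fun x => ∫ s in (0 : ℝ)..x, F s with hG
  have dG : ∀ x, HasDerivAt G (F x) x := fun x => (cF.integral_hasStrictDerivAt 0 x).hasDerivAt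
  refine ⟨fun x => G x - G b / b * x, fun x => F x - G b / b, fun x => ?_, fun x => ?_, ?_, ?_⟩
  · simpa using (dG x).fun_sub ((hasDerivAt_id x).const_mul (G b / b))
  · simpa using (dF x).sub_const (G b / b)
  · simp [hG]
  · field_simp
    ring

/-- A duality argument: given `χ`, take `k'' = χ` with `k(0) = k(π) = 0`, so that `∫ w χ n = ∫ w_xx
k n = 0`. The fundamental lemma is then applied in `x` and afterwards in `y`. -/
lemma eqOn_zero_of_dxx (hℓ : 0 < ℓ) (w : H2Star ℓ)
    (hw : w.dxx =ᵐ[volume.restrict (plate ℓ)] 0) : ∀ p ∈ closedPlate ℓ, w.toFun p = 0 := by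
  have hslice : ∀ n, Continuous n → ∀ x ∈ Icc 0 Real.pi, slice (-ℓ) ℓ w.toFun n x = 0 := by
    intro n hn
    refine eqOn_zero_of_forall_bump Real.pi_pos (continuousOn_slice w.continuousOn hn)
      fun χ hχ => ?_
    obtain ⟨k, k', hk, hk', h0, hπ⟩ := exists_second_primitive hχ.continuous Real.pi_ne_zero
    have h1 := w.integral_dxx_mul hk hk' hχ.continuous h0 hπ hn
    have hi := w.integrableOn_toFun
    rw [plate] at h1 hi
    rw [setIntegral_mul_mul hi hχ.continuous hn] at h1
    rw [← h1]
    exact integral_eq_zero_of_ae (hw.mono fun p hp => by simp [hp])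
  rintro ⟨x, y⟩ ⟨hx, hy⟩
  refine eqOn_zero_of_forall_bump (f := fun y => w.toFun (x, y)) (by linarith : -ℓ < ℓ) ?_
    (fun n hn => hslice n hn.continuous x hx) y hy
  exact w.continuousOn.comp (by fun_prop) fun y hy => ⟨hx, hy⟩

/-- Uniqueness of the weak solution. -/
lemma _root_.IsWeakSolution.eqOn {σ : ℝ} (hσ0 : 0 ≤ σ) (hσ1 : σ < 1) (hℓ : 0 < ℓ)
    {f : ℝ × ℝ → ℝ} {u w : H2Star ℓ} (hu : IsWeakSolution σ f u) (hw : IsWeakSolution σ f w) :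
    EqOn w.toFun u.toFun (closedPlate ℓ) := by
  have h0 : scalarProduct σ (w - u) (w - u) = 0 := by
    rw [scalarProduct_sub_left, hw, hu, sub_self]
  intro p hp
  have := eqOn_zero_of_dxx hℓ _ (dxx_ae_eq_zero hσ0 hσ1 _ h0) p hp
  exact sub_eq_zero.1 this

end H2Star

/-! ### The boundary systems for the coefficients and the explicit solution. -/

lemma exists_solution_of_det_ne_zero {a b c d : ℝ} (h : a * d - b * c ≠ 0) (r s : ℝ) :
    ∃ x y, a * x + b * y = r ∧ c * x + d * y = s :=
  ⟨(r * d - b * s) / (a * d - b * c), (a * s - c * r) / (a * d - b * c),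
    by rw [mul_div_assoc', mul_div_assoc', ← add_div, div_eq_iff h]; ring,
    by rw [mul_div_assoc', mul_div_assoc', ← add_div, div_eq_iff h]; ring⟩

section Coefficients

variable {σ ℓ α : ℝ}

lemma denom_pos (hσ0 : 0 < σ) (hσ1 : σ < 1) (hℓ : 0 < ℓ) : 0 < denom σ ℓ := by
  have := Real.sinh_pos_iff.2 hℓ
  have := Real.cosh_pos ℓ
  have : 0 < 1 - σ := by linarith
  unfold denom
  positivity

lemma sq_sub_one_ne_zero (hα : 0 < α) (hα1 : α ≠ 1) : α ^ 2 - 1 ≠ 0 := by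
  rw [sub_ne_zero]
  intro h
  exact hα1 ((pow_eq_one_iff_of_nonneg hα.le two_ne_zero).1 h)

/-- This is `φ'' - σφ = 0` at `y = ℓ` for the odd part of the profile, divided by the load amplitude
`α/(4 sinh(αℓ))`. -/
lemma coeff_moment (hσ0 : 0 < σ) (hσ1 : σ < 1) (hℓ : 0 < ℓ) (hα : 0 < α) (hα1 : α ≠ 1) :
    (α ^ 2 - σ) * Real.sinh (α * ℓ) / (α ^ 2 - 1) ^ 2
      + (1 - σ) * Real.sinh ℓ * coeffB σ ℓ α
      + (2 * Real.sinh ℓ + (1 - σ) * (ℓ * Real.cosh ℓ)) * coeffC σ ℓ α = 0 := by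
  have hq := (denom_pos hσ0 hσ1 hℓ).ne'
  have hd := sq_sub_one_ne_zero hα hα1
  have h1 : 1 - σ ≠ 0 := by linarith
  unfold coeffB coeffC
  field_simp
  unfold denom
  linear_combination (-(α ^ 2 - σ) * (1 - σ) * ℓ * Real.sinh (α * ℓ)) * Real.cosh_sq ℓ

lemma coeff_shear (hσ0 : 0 < σ) (hσ1 : σ < 1) (hℓ : 0 < ℓ) (hα : 0 < α) (hα1 : α ≠ 1) :
    α * (α ^ 2 - 2 + σ) * Real.cosh (α * ℓ) / (α ^ 2 - 1) ^ 2
      - (1 - σ) * Real.cosh ℓ * coeffB σ ℓ α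
      + ((1 + σ) * Real.cosh ℓ - (1 - σ) * (ℓ * Real.sinh ℓ)) * coeffC σ ℓ α = 0 := by
  have hq := (denom_pos hσ0 hσ1 hℓ).ne'
  have hd := sq_sub_one_ne_zero hα hα1
  have h1 : 1 - σ ≠ 0 := by linarith
  unfold coeffB coeffC
  field_simp
  unfold denom
  linear_combination (-(α * (α ^ 2 - 2 + σ)) * (1 - σ) * ℓ * Real.cosh (α * ℓ)) * Real.cosh_sq ℓ

/-- The even part of the reduced boundary conditions is solvable. -/
lemma exists_even_coeff (hσ0 : 0 < σ) (hσ1 : σ < 1) (hℓ : 0 < ℓ) (r s : ℝ) :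
    ∃ A D, (1 - σ) * Real.cosh ℓ * A
        + (2 * Real.cosh ℓ + (1 - σ) * (ℓ * Real.sinh ℓ)) * D = r ∧
      (-(1 - σ) * Real.sinh ℓ) * A
        + ((1 + σ) * Real.sinh ℓ - (1 - σ) * (ℓ * Real.cosh ℓ)) * D = s := by
  refine exists_solution_of_det_ne_zero (ne_of_gt ?_) r s
  have hs : ℓ < Real.sinh ℓ := Real.self_lt_sinh_iff.2 hℓ
  have hc : 1 ≤ Real.cosh ℓ := Real.one_le_cosh ℓ
  have h1 : 0 < 1 - σ := by linarith
  have hsc : ℓ < Real.sinh ℓ * Real.cosh ℓ :=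
    hs.trans_le (le_mul_of_one_le_right (hℓ.trans hs).le hc)
  have e : (1 - σ) * Real.cosh ℓ * ((1 + σ) * Real.sinh ℓ - (1 - σ) * (ℓ * Real.cosh ℓ))
      - (2 * Real.cosh ℓ + (1 - σ) * (ℓ * Real.sinh ℓ)) * (-(1 - σ) * Real.sinh ℓ)
      = (1 - σ) * ((1 - σ) * (Real.sinh ℓ * Real.cosh ℓ - ℓ)
        + (2 + 2 * σ) * (Real.sinh ℓ * Real.cosh ℓ)) := by
    linear_combination (-(1 - σ) ^ 2 * ℓ) * Real.cosh_sq ℓ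
  rw [e]
  have : 0 < Real.sinh ℓ * Real.cosh ℓ - ℓ := by linarith
  have : 0 < Real.sinh ℓ * Real.cosh ℓ := hℓ.trans hsc
  positivity

/-- The explicit solution for the load `f_α`, with its gap. -/
lemma exists_solution (hσ0 : 0 < σ) (hσ1 : σ < 1) (hℓ : 0 < ℓ) (hα : 0 < α) (hα1 : α ≠ 1) :
    ∃ u : H2Star ℓ, IsWeakSolution σ (load ℓ α) u ∧
      IsClassicalSolution σ ℓ (load ℓ α) u.toFun ∧
      ∀ x, gap ℓ u.toFun x = gapCoeff σ ℓ α * Real.sin x := by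
  have hd := sq_sub_one_ne_zero hα hα1
  have hS : Real.sinh (α * ℓ) ≠ 0 := (Real.sinh_pos_iff.2 (mul_pos hα hℓ)).ne'
  set κ := α / (4 * Real.sinh (α * ℓ)) with hκ
  set c := κ / (α ^ 2 - 1) ^ 2 with hc
  set B := κ * coeffB σ ℓ α with hB
  set C := κ * coeffC σ ℓ α with hC
  obtain ⟨A, D, even₂, even₃⟩ := exists_even_coeff hσ0 hσ1 hℓ
    (-(c * (α ^ 2 - σ) * Real.cosh (α * ℓ))) (-(c * α * (α ^ 2 - 2 + σ) * Real.sinh (α * ℓ)))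
  have odd₂ := coeff_moment hσ0 hσ1 hℓ hα hα1
  have odd₃ := coeff_shear hσ0 hσ1 hℓ hα hα1
  have hep : Real.exp (α * ℓ) = Real.cosh (α * ℓ) + Real.sinh (α * ℓ) :=
    (Real.cosh_add_sinh _).symm
  have hem : Real.exp (α * -ℓ) = Real.cosh (α * ℓ) - Real.sinh (α * ℓ) := by
    rw [Real.cosh_sub_sinh, mul_neg]
  have d₁ := hasDerivAt_profile α c A B C D
  have d₂ := hasDerivAt_profile α (c * α) (B + C) (A + D) D C
  have d₃ := hasDerivAt_profile α (c * α * α) (A + D + D) (B + C + C) C D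
  have d₄ := hasDerivAt_profile α (c * α * α * α) (B + C + C + C) (A + D + D + D) D C
  have free₂ : ∀ y ∈ ({-ℓ, ℓ} : Set ℝ),
      profile α (c * α * α) (A + D + D) (B + C + C) C D y - σ * profile α c A B C D y = 0 := by
    rintro y (rfl | rfl)
    · simp only [profile, hem, Real.cosh_neg, Real.sinh_neg]
      linear_combination even₂ - κ * odd₂
    · simp only [profile, hep]
      linear_combination even₂ + κ * odd₂
  have free₃ : ∀ y ∈ ({-ℓ, ℓ} : Set ℝ),
      profile α (c * α * α * α) (B + C + C + C) (A + D + D + D) D C y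
        - (2 - σ) * profile α (c * α) (B + C) (A + D) D C y = 0 := by
    rintro y (rfl | rfl)
    · simp only [profile, hem, Real.cosh_neg, Real.sinh_neg]
      linear_combination κ * odd₃ - even₃
    · simp only [profile, hep]
      linear_combination κ * odd₃ + even₃
  have hcκ : c * (α ^ 2 - 1) ^ 2 = κ := by
    rw [hc]
    field_simp
  have hf : ∀ p : ℝ × ℝ, Real.sin p.1 * (profile α (c * α * α * α * α) (A + D + D + D + D)
      (B + C + C + C + C) C D p.2 - 2 * profile α (c * α * α) (A + D + D) (B + C + C) C D p.2
        + profile α c A B C D p.2) = load ℓ α p := fun p => by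
    have e : load ℓ α p = κ * Real.exp (α * p.2) * Real.sin p.1 := by
      rw [load, hκ]
      ring
    rw [e]
    simp only [profile]
    linear_combination Real.exp (α * p.2) * Real.sin p.1 * hcκ
  refine ⟨H2Star.sinMul ℓ (contDiff_profile α c A B C D), fun v => ?_,
    isClassicalSolution_sin_mul (contDiff_profile α c A B C D) d₁ d₂ d₃ d₄ hf free₂ free₃,
    fun x => ?_⟩
  · rw [H2Star.scalarProduct_sinMul hℓ _ d₁ d₂ d₃ d₄
      (contDiff_profile _ _ _ _ _ _).continuous free₂ free₃]
    simp only [hf]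
  · change Real.sin x * profile α c A B C D ℓ - Real.sin x * profile α c A B C D (-ℓ) = _
    have e1 : 2 * (c * Real.sinh (α * ℓ)) = α / (2 * (1 - α ^ 2) ^ 2) := by
      rw [hc, hκ, show (1 - α ^ 2) ^ 2 = (α ^ 2 - 1) ^ 2 by ring]
      field_simp
      norm_num
    have e2 : 2 * (B * Real.sinh ℓ) = α * coeffB σ ℓ α * Real.sinh ℓ / (2 * Real.sinh (α * ℓ)) := by
      rw [hB, hκ]
      field_simp
      norm_num
    have e3 : 2 * (C * (ℓ * Real.cosh ℓ))
        = α * coeffC σ ℓ α * ℓ * Real.cosh ℓ / (2 * Real.sinh (α * ℓ)) := by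
      rw [hC, hκ]
      field_simp
      norm_num
    rw [gapCoeff, ← e1, ← e2, ← e3]
    simp only [profile, hem, hep, Real.cosh_neg, Real.sinh_neg]
    ring

end Coefficients

section Amplitude

variable {σ ℓ α : ℝ}

/-- Positivity of the reduced solution of the dual problem, whose load is the gap functional. -/
lemma sinh_mul_mul_cosh_le (y : ℝ) (h0 : 0 ≤ y) (hy : y ≤ ℓ) :
    Real.sinh ℓ * (y * Real.cosh y)
      ≤ (2 * Real.sinh ℓ + ℓ * Real.cosh ℓ) * Real.sinh y := by
  have h1 : Real.sinh (ℓ - y) = Real.sinh ℓ * Real.cosh y - Real.cosh ℓ * Real.sinh y :=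
    Real.sinh_sub ℓ y
  have h2 : y ≤ Real.sinh y := Real.self_le_sinh_iff.2 h0
  have h3 : Real.sinh (ℓ - y) ≤ Real.sinh ℓ := Real.sinh_le_sinh.2 (by linarith)
  have h4 : 0 ≤ Real.sinh (ℓ - y) := Real.sinh_nonneg_iff.2 (by linarith)
  have h5 : 0 ≤ Real.sinh y := Real.sinh_nonneg_iff.2 h0
  have h6 : y * Real.sinh (ℓ - y) ≤ Real.sinh y * Real.sinh ℓ := mul_le_mul h2 h3 h4 h5
  have h7 : y * (Real.cosh ℓ * Real.sinh y) ≤ ℓ * (Real.cosh ℓ * Real.sinh y) :=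
    mul_le_mul_of_nonneg_right hy (mul_nonneg (Real.cosh_pos ℓ).le h5)
  have h8 : 0 ≤ Real.sinh ℓ * Real.sinh y :=
    mul_nonneg (Real.sinh_nonneg_iff.2 (h0.trans hy)) h5
  have h9 : y * Real.sinh (ℓ - y)
      = Real.sinh ℓ * (y * Real.cosh y) - y * (Real.cosh ℓ * Real.sinh y) := by
    rw [h1]; ring
  nlinarith

/-- A primitive of `y ↦ sinh (αy) (μ sinh y - ν y cosh y)`. -/
noncomputable def pairingPrimitive (α μ ν y : ℝ) : ℝ :=
  μ * ((α * (Real.cosh (α * y) * Real.sinh y) - Real.sinh (α * y) * Real.cosh y) / (α ^ 2 - 1))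
    - ν * (y * ((α * (Real.cosh (α * y) * Real.cosh y) - Real.sinh (α * y) * Real.sinh y)
        / (α ^ 2 - 1))
      - ((α ^ 2 + 1) * (Real.sinh (α * y) * Real.cosh y)
        - 2 * α * (Real.cosh (α * y) * Real.sinh y)) / (α ^ 2 - 1) ^ 2)

lemma hasDerivAt_pairingPrimitive (hα : α ^ 2 - 1 ≠ 0) (μ ν y : ℝ) :
    HasDerivAt (pairingPrimitive α μ ν)
      (Real.sinh (α * y) * (μ * Real.sinh y - ν * (y * Real.cosh y))) y := by
  have hl : HasDerivAt (fun y => α * y) (α * 1) y := (hasDerivAt_id y).const_mul α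
  have hC := hl.cosh
  have hS := hl.sinh
  have hc := Real.hasDerivAt_cosh y
  have hs := Real.hasDerivAt_sinh y
  have h1 := ((((hC.mul hs).const_mul α).sub (hS.mul hc)).div_const (α ^ 2 - 1)).const_mul μ
  have h2 := ((hasDerivAt_id y).mul
    ((((hC.mul hc).const_mul α).sub (hS.mul hs)).div_const (α ^ 2 - 1)))
  have h3 := (((hS.mul hc).const_mul (α ^ 2 + 1)).sub
    ((hC.mul hs).const_mul (2 * α))).div_const ((α ^ 2 - 1) ^ 2)
  refine (h1.sub ((h2.sub h3).const_mul ν)).congr_deriv ?_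
  simp only [id, Pi.mul_apply, Pi.sub_apply]
  field_simp
  ring

lemma gapCoeff_eq_pairing (hσ0 : 0 < σ) (hσ1 : σ < 1) (hℓ : 0 < ℓ) (hα : 0 < α) (hα1 : α ≠ 1) :
    gapCoeff σ ℓ α = α / (2 * Real.sinh (α * ℓ) * denom σ ℓ)
      * pairingPrimitive α (2 * Real.sinh ℓ / (1 - σ) + ℓ * Real.cosh ℓ) (Real.sinh ℓ) ℓ := by
  have hq := (denom_pos hσ0 hσ1 hℓ).ne'
  have hd := sq_sub_one_ne_zero hα hα1
  have h1 : 1 - σ ≠ 0 := by linarith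
  have hS : Real.sinh (α * ℓ) ≠ 0 := (Real.sinh_pos_iff.2 (mul_pos hα hℓ)).ne'
  have e1 : (1 - α ^ 2) ^ 2 = (α ^ 2 - 1) ^ 2 := by ring
  rw [gapCoeff, coeffB, coeffC, pairingPrimitive, e1]
  field_simp
  unfold denom
  linear_combination (-(ℓ * (1 - σ) ^ 2 * Real.sinh (α * ℓ))) * Real.cosh_sq ℓ

lemma gapCoeff_nonneg (hσ0 : 0 < σ) (hσ1 : σ < 1) (hℓ : 0 < ℓ) (hα : 0 < α) (hα1 : α ≠ 1) :
    0 ≤ gapCoeff σ ℓ α := by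
  rw [gapCoeff_eq_pairing hσ0 hσ1 hℓ hα hα1]
  have hS : 0 < Real.sinh (α * ℓ) := Real.sinh_pos_iff.2 (mul_pos hα hℓ)
  have hs : 0 < Real.sinh ℓ := Real.sinh_pos_iff.2 hℓ
  have hq := denom_pos hσ0 hσ1 hℓ
  refine mul_nonneg (by positivity) ?_
  set μ := 2 * Real.sinh ℓ / (1 - σ) + ℓ * Real.cosh ℓ with hμ
  have hμ' : 2 * Real.sinh ℓ + ℓ * Real.cosh ℓ ≤ μ := by
    have : 2 * Real.sinh ℓ ≤ 2 * Real.sinh ℓ / (1 - σ) :=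
      le_div_self (by positivity) (by linarith) (by linarith)
    linarith
  have hder := hasDerivAt_pairingPrimitive (sq_sub_one_ne_zero hα hα1) μ (Real.sinh ℓ)
  have hmono : MonotoneOn (pairingPrimitive α μ (Real.sinh ℓ)) (Icc 0 ℓ) := by
    refine monotoneOn_of_hasDerivWithinAt_nonneg (convex_Icc 0 ℓ)
      (fun y _ => (hder y).continuousAt.continuousWithinAt)
      (fun y _ => (hder y).hasDerivWithinAt) fun y hy => ?_
    rw [interior_Icc] at hy
    have hy0 : 0 ≤ Real.sinh y := Real.sinh_nonneg_iff.2 hy.1.le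
    refine mul_nonneg (Real.sinh_nonneg_iff.2 (mul_nonneg hα.le hy.1.le)) ?_
    linarith [sinh_mul_mul_cosh_le y hy.1.le hy.2.le, mul_le_mul_of_nonneg_right hμ' hy0]
  have := hmono (left_mem_Icc.2 hℓ.le) (right_mem_Icc.2 hℓ.le) hℓ.le
  simpa [pairingPrimitive] using this

end Amplitude

section Asymptotics

variable {σ ℓ : ℝ}

/-- The slope of the amplitude with respect to `1 / α` at infinity. -/
noncomputable def gapCoeffSlope (σ ℓ : ℝ) : ℝ :=
  ((1 + σ) * Real.cosh ℓ * Real.sinh ℓ + (1 - σ) * ℓ) /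
    (2 * (1 - σ) * ((3 + σ) * Real.cosh ℓ * Real.sinh ℓ + (1 - σ) * ℓ))

/-- The part of the amplitude, in the variable `β = 1 / α`, multiplying `coth (αℓ)`. -/
noncomputable def amplitudeCoth (σ ℓ β : ℝ) : ℝ :=
  (Real.sinh ℓ * (1 + (σ - 2) * β ^ 2) * (2 * Real.sinh ℓ + (1 - σ) * ℓ * Real.cosh ℓ)
      + (1 - σ) * (ℓ * Real.cosh ℓ * Real.sinh ℓ * ((2 - σ) * β ^ 2 - 1)))
    / (2 * (1 - σ) * denom σ ℓ * (1 - β ^ 2) ^ 2)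

/-- The remaining part of the amplitude, in the variable `β = 1 / α`. -/
noncomputable def amplitudeRest (σ ℓ β : ℝ) : ℝ :=
  ((1 - σ) * denom σ ℓ * β ^ 3
      + Real.sinh ℓ * β * ((1 + σ) * (σ * β ^ 2 - 1) * Real.cosh ℓ
        + (1 - σ) * (1 - σ * β ^ 2) * ℓ * Real.sinh ℓ)
      + (1 - σ) * (ℓ * Real.cosh ℓ * β * (σ * β ^ 2 - 1) * Real.cosh ℓ))
    / (2 * (1 - σ) * denom σ ℓ * (1 - β ^ 2) ^ 2)

lemma gapCoeff_eq_amplitude {α : ℝ} (hσ0 : 0 < σ) (hσ1 : σ < 1) (hℓ : 0 < ℓ) (hα : 0 < α)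
    (hα1 : α ≠ 1) : gapCoeff σ ℓ α
      = amplitudeCoth σ ℓ (1 / α) * (Real.cosh (α * ℓ) / Real.sinh (α * ℓ))
        + amplitudeRest σ ℓ (1 / α) := by
  have hq := (denom_pos hσ0 hσ1 hℓ).ne'
  have hd := sq_sub_one_ne_zero hα hα1
  have h1 : 1 - σ ≠ 0 := by linarith
  have hS : Real.sinh (α * ℓ) ≠ 0 := (Real.sinh_pos_iff.2 (mul_pos hα hℓ)).ne'
  have e1 : (1 - α ^ 2) ^ 2 = (α ^ 2 - 1) ^ 2 := by ring
  have e2 : 1 - (1 / α) ^ 2 = (α ^ 2 - 1) / α ^ 2 := by field_simp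
  rw [gapCoeff, coeffB, coeffC, amplitudeCoth, amplitudeRest, e1, e2]
  field_simp
  ring

lemma tendsto_mul_coth_sub_one (hℓ : 0 < ℓ) :
    Tendsto (fun α : ℝ => α * (Real.cosh (α * ℓ) / Real.sinh (α * ℓ) - 1)) atTop (𝓝 0) := by
  have hlim : Tendsto (fun α : ℝ => Real.exp (-(α * ℓ)) / ℓ) atTop (𝓝 0) := by
    have := (Real.tendsto_exp_neg_atTop_nhds_zero.comp
      (tendsto_id.atTop_mul_const hℓ)).div_const ℓ
    simpa using this
  refine squeeze_zero' ?_ ?_ hlim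
  · filter_upwards [eventually_gt_atTop 0] with α hα
    have hS : 0 < Real.sinh (α * ℓ) := Real.sinh_pos_iff.2 (mul_pos hα hℓ)
    refine mul_nonneg hα.le (sub_nonneg.2 ((one_le_div hS).2 (Real.sinh_lt_cosh _).le))
  · filter_upwards [eventually_gt_atTop 0] with α hα
    have hαℓ := mul_pos hα hℓ
    have hS : 0 < Real.sinh (α * ℓ) := Real.sinh_pos_iff.2 hαℓ
    have hle : α * ℓ ≤ Real.sinh (α * ℓ) := Real.self_le_sinh_iff.2 hαℓ.le
    rw [div_sub_one hS.ne', Real.cosh_sub_sinh, mul_div_assoc', div_le_div_iff₀ hS hℓ]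
    nlinarith [Real.exp_pos (-(α * ℓ))]

lemma hasDerivAt_div_one_sub_sq {P : ℝ → ℝ} {P' : ℝ} (hP : HasDerivAt P P' 0) {K : ℝ}
    (hK : K ≠ 0) : HasDerivAt (fun β => P β / (K * (1 - β ^ 2) ^ 2)) (P' / K) 0 := by
  have h2 : HasDerivAt (fun β : ℝ => K * (1 - β ^ 2) ^ 2) 0 0 := by
    have := ((((hasDerivAt_id (0 : ℝ)).pow 2).const_sub 1).pow 2).const_mul K
    simpa using this
  have := hP.fun_div h2 (by simpa using hK)
  refine this.congr_deriv ?_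
  field_simp
  simp

lemma hasDerivAt_amplitudeCoth (hσ0 : 0 < σ) (hσ1 : σ < 1) (hℓ : 0 < ℓ) :
    HasDerivAt (amplitudeCoth σ ℓ) 0 0 := by
  have hK : 2 * (1 - σ) * denom σ ℓ ≠ 0 :=
    mul_ne_zero (by linarith) (denom_pos hσ0 hσ1 hℓ).ne'
  have hsq : HasDerivAt (fun β : ℝ => β ^ 2) 0 0 := by
    simpa using (hasDerivAt_id (0 : ℝ)).fun_pow 2
  have hP := ((((hsq.const_mul (σ - 2)).const_add 1).const_mul (Real.sinh ℓ)).mul_const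
    (2 * Real.sinh ℓ + (1 - σ) * ℓ * Real.cosh ℓ)).fun_add
    ((((hsq.const_mul (2 - σ)).sub_const 1).const_mul
      (ℓ * Real.cosh ℓ * Real.sinh ℓ)).const_mul (1 - σ))
  exact (hasDerivAt_div_one_sub_sq hP hK).congr_deriv (by simp)

lemma hasDerivAt_amplitudeRest (hσ0 : 0 < σ) (hσ1 : σ < 1) (hℓ : 0 < ℓ) :
    HasDerivAt (amplitudeRest σ ℓ) (-gapCoeffSlope σ ℓ) 0 := by
  have hq := (denom_pos hσ0 hσ1 hℓ).ne'
  have hK : 2 * (1 - σ) * denom σ ℓ ≠ 0 := mul_ne_zero (by linarith) hq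
  have hsq : HasDerivAt (fun β : ℝ => β ^ 2) 0 0 := by
    simpa using (hasDerivAt_id (0 : ℝ)).fun_pow 2
  have hcu : HasDerivAt (fun β : ℝ => β ^ 3) 0 0 := by
    simpa using (hasDerivAt_id (0 : ℝ)).fun_pow 3
  have hid : HasDerivAt (fun β : ℝ => β) 1 0 := hasDerivAt_id 0
  have hP := ((hcu.const_mul ((1 - σ) * denom σ ℓ)).fun_add
    ((hid.const_mul (Real.sinh ℓ)).fun_mul
      (((((hsq.const_mul σ).sub_const 1).const_mul (1 + σ)).mul_const (Real.cosh ℓ)).fun_add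
        (((((hsq.const_mul σ).const_sub 1).const_mul (1 - σ)).mul_const ℓ).mul_const
          (Real.sinh ℓ))))).fun_add
    ((((hid.const_mul (ℓ * Real.cosh ℓ)).fun_mul ((hsq.const_mul σ).sub_const 1)).mul_const
      (Real.cosh ℓ)).const_mul (1 - σ))
  refine (hasDerivAt_div_one_sub_sq hP hK).congr_deriv ?_
  rw [gapCoeffSlope, ← denom, neg_div', div_left_inj' hK]
  linear_combination (-(1 - σ) * ℓ) * Real.cosh_sq ℓ

lemma amplitudeCoth_zero (hσ0 : 0 < σ) (hσ1 : σ < 1) (hℓ : 0 < ℓ) :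
    amplitudeCoth σ ℓ 0 = gapCoeffLimit σ ℓ := by
  have hq := (denom_pos hσ0 hσ1 hℓ).ne'
  have h1 : 1 - σ ≠ 0 := by linarith
  have e : (1 - σ) * ℓ + (3 + σ) * Real.sinh ℓ * Real.cosh ℓ = denom σ ℓ := by
    rw [denom]; ring
  rw [amplitudeCoth, gapCoeffLimit, e]
  field_simp
  ring

lemma amplitudeRest_zero : amplitudeRest σ ℓ 0 = 0 := by
  simp [amplitudeRest]

/-- First order expansion of the amplitude at infinity. -/
lemma isLittleO_gapCoeff (hσ0 : 0 < σ) (hσ1 : σ < 1) (hℓ : 0 < ℓ) :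
    (fun α : ℝ => gapCoeff σ ℓ α - (gapCoeffLimit σ ℓ - 1 / α * gapCoeffSlope σ ℓ))
      =o[atTop] (fun α : ℝ => 1 / α) := by
  have hβ : Tendsto (fun α : ℝ => 1 / α) atTop (𝓝 0) := by
    simpa using tendsto_inv_atTop_zero (𝕜 := ℝ)
  have hM := hasDerivAt_amplitudeCoth hσ0 hσ1 hℓ
  have hsum := hM.fun_add (hasDerivAt_amplitudeRest hσ0 hσ1 hℓ)
  have h1 := (hasDerivAt_iff_isLittleO_nhds_zero.1 hsum).comp_tendsto hβ
  have hbig : (fun α : ℝ => amplitudeCoth σ ℓ (1 / α)) =O[atTop] (fun _ => (1 : ℝ)) :=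
    (hM.continuousAt.tendsto.comp hβ).isBigO_one ℝ
  have hcoth : (fun α : ℝ => Real.cosh (α * ℓ) / Real.sinh (α * ℓ) - 1)
      =o[atTop] (fun α : ℝ => 1 / α) := by
    refine (Asymptotics.isLittleO_iff_tendsto' ?_).2 ?_
    · filter_upwards [eventually_gt_atTop 0] with α hα h
      exact absurd h (one_div_pos.2 hα).ne'
    · refine (tendsto_mul_coth_sub_one hℓ).congr fun α => ?_
      rw [div_div_eq_mul_div, div_one, mul_comm]
  have h2 := hbig.mul_isLittleO hcoth
  simp only [one_mul] at h2
  refine (h1.add h2).congr' ?_ EventuallyEq.rfl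
  filter_upwards [eventually_gt_atTop 1] with α hα
  rw [gapCoeff_eq_amplitude hσ0 hσ1 hℓ (by linarith) hα.ne']
  simp only [Function.comp, zero_add, amplitudeRest_zero, amplitudeCoth_zero hσ0 hσ1 hℓ,
    smul_eq_mul]
  ring

lemma tendsto_gapCoeff (hσ0 : 0 < σ) (hσ1 : σ < 1) (hℓ : 0 < ℓ) :
    Tendsto (gapCoeff σ ℓ) atTop (𝓝 (gapCoeffLimit σ ℓ)) := by
  have hβ : Tendsto (fun α : ℝ => 1 / α) atTop (𝓝 0) := by
    simpa using tendsto_inv_atTop_zero (𝕜 := ℝ)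
  have h1 := (isLittleO_gapCoeff hσ0 hσ1 hℓ).isBigO.trans_tendsto hβ
  have h2 := h1.add ((hβ.mul_const (gapCoeffSlope σ ℓ)).const_sub (gapCoeffLimit σ ℓ))
  simpa using h2

end Asymptotics

/-- The maximum of `|E sin x|` over `[0, π]`. -/
lemma isGreatest_abs_mul_sin {ℓ E : ℝ} {u : ℝ × ℝ → ℝ} (hE : 0 ≤ E)
    (h : ∀ x ∈ Icc 0 Real.pi, gap ℓ u x = E * Real.sin x) :
    IsGreatest ((fun x => |gap ℓ u x|) '' Icc 0 Real.pi) E := by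
  refine ⟨⟨Real.pi / 2, ⟨by positivity, by linarith [Real.pi_pos]⟩, ?_⟩, ?_⟩
  · simp only
    rw [h _ ⟨by positivity, by linarith [Real.pi_pos]⟩, Real.sin_pi_div_two, mul_one,
      abs_of_nonneg hE]
  · rintro _ ⟨x, hx, rfl⟩
    simp only
    rw [h x hx, abs_mul, abs_of_nonneg hE]
    exact mul_le_of_le_one_right hE (Real.abs_sin_le_one x)

theorem theorem2p2 (σ ℓ : ℝ) (hσ0 : 0 < σ) (hσ1 : σ < 1) (hℓ : 0 < ℓ) :
    -- the solution exists, is unique, and solves the boundary value problem pointwise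
    (∀ α : ℝ, 0 < α → α ≠ 1 →
      ∃ u : H2Star ℓ, IsWeakSolution σ (load ℓ α) u ∧
        IsClassicalSolution σ ℓ (load ℓ α) u.toFun ∧
        ∀ w : H2Star ℓ, IsWeakSolution σ (load ℓ α) w →
          Set.EqOn w.toFun u.toFun (closedPlate ℓ)) ∧
    -- the gap function of the solution
    (∀ u : ℝ → H2Star ℓ,
      (∀ α : ℝ, 0 < α → α ≠ 1 → IsWeakSolution σ (load ℓ α) (u α)) →
      (∀ α : ℝ, 0 < α → α ≠ 1 →
        (∀ x ∈ Set.Icc 0 Real.pi,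
          gap ℓ (u α).toFun x = gapCoeff σ ℓ α * Real.sin x) ∧
        IsGreatest ((fun x => |gap ℓ (u α).toFun x|) '' Set.Icc 0 Real.pi)
          (maxGap ℓ (u α).toFun) ∧
        maxGap ℓ (u α).toFun = gapCoeff σ ℓ α) ∧
      TendstoUniformlyOn (fun α x => gap ℓ (u α).toFun x)
        (fun x => gapCoeffLimit σ ℓ * Real.sin x) Filter.atTop (Set.Icc 0 Real.pi) ∧
      (fun α : ℝ => maxGap ℓ (u α).toFun -
          (gapCoeffLimit σ ℓ - 1 / α *
            (((1 + σ) * Real.cosh ℓ * Real.sinh ℓ + (1 - σ) * ℓ) /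
              (2 * (1 - σ) * ((3 + σ) * Real.cosh ℓ * Real.sinh ℓ + (1 - σ) * ℓ)))))
        =o[Filter.atTop] (fun α : ℝ => 1 / α)) := by

  have hsol : ∀ α : ℝ, 0 < α → α ≠ 1 → ∃ u : H2Star ℓ, IsWeakSolution σ (load ℓ α) u ∧
      IsClassicalSolution σ ℓ (load ℓ α) u.toFun ∧
      ∀ x, gap ℓ u.toFun x = gapCoeff σ ℓ α * Real.sin x := fun α hα hα1 =>
    exists_solution hσ0 hσ1 hℓ hα hα1
  refine ⟨fun α hα hα1 => ?_, fun u hu => ?_⟩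
  · obtain ⟨u, hu, hcl, -⟩ := hsol α hα hα1
    exact ⟨u, hu, hcl, fun w hw => hu.eqOn hσ0.le hσ1 hℓ hw⟩
  have hgap : ∀ α : ℝ, 0 < α → α ≠ 1 → ∀ x ∈ Set.Icc 0 Real.pi,
      gap ℓ (u α).toFun x = gapCoeff σ ℓ α * Real.sin x := by
    intro α hα hα1 x hx
    obtain ⟨v, hv, -, hg⟩ := hsol α hα hα1
    have heq := hv.eqOn hσ0.le hσ1 hℓ (hu α hα hα1)
    rw [← hg x, gap, gap, heq (show (x, ℓ) ∈ closedPlate ℓ from ⟨hx, by constructor <;> linarith⟩),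
      heq (show (x, -ℓ) ∈ closedPlate ℓ from ⟨hx, by constructor <;> linarith⟩)]
  have hmax : ∀ α : ℝ, 0 < α → α ≠ 1 →
      IsGreatest ((fun x => |gap ℓ (u α).toFun x|) '' Set.Icc 0 Real.pi) (gapCoeff σ ℓ α) :=
    fun α hα hα1 => isGreatest_abs_mul_sin (gapCoeff_nonneg hσ0 hσ1 hℓ hα hα1) (hgap α hα hα1)
  have hmaxGap : ∀ α : ℝ, 0 < α → α ≠ 1 → maxGap ℓ (u α).toFun = gapCoeff σ ℓ α :=
    fun α hα hα1 => (hmax α hα hα1).csSup_eq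
  refine ⟨fun α hα hα1 => ⟨hgap α hα hα1, ?_, hmaxGap α hα hα1⟩, ?_, ?_⟩
  · rw [hmaxGap α hα hα1]
    exact hmax α hα hα1
  · rw [Metric.tendstoUniformlyOn_iff]
    intro ε hε
    filter_upwards [(Metric.tendsto_nhds.1 (tendsto_gapCoeff hσ0 hσ1 hℓ)) ε hε,
      eventually_gt_atTop 1] with α hα hα1 x hx
    rw [hgap α (by linarith) hα1.ne' x hx, dist_comm, Real.dist_eq, ← sub_mul, abs_mul]
    rw [Real.dist_eq] at hα
    exact (mul_le_of_le_one_right (abs_nonneg _) (Real.abs_sin_le_one x)).trans_lt hα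
  · refine (isLittleO_gapCoeff hσ0 hσ1 hℓ).congr' ?_ EventuallyEq.rfl
    filter_upwards [eventually_gt_atTop 1] with α hα
    rw [hmaxGap α (by linarith) hα.ne', gapCoeffSlope]
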